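/- Let $a\in\mathbb{C}$ with $\operatorname{Re} a>0$. Let $\log\Gamma(a)$ denote the holomorphic branch of the logarithm of the Gamma function on the right half-plane that is real on the positive axis, let $\gamma$ be Euler's constant and $\psi=\Gamma'/\Gamma$. For $0<\epsilon<2\pi$ let $L=L_\epsilon$ be the Hankel contour consisting of the lower side ($\arg z=-\pi$) of the ray $(-\infty,-\epsilon)$ traced from left to right, the circle $z=\epsilon e^{i\theta}$, $-\pi\le\theta\le\pi$, traced counterclockwise, and the upper side ($\arg z=\pi$) of the ray traced from right to left; on $L$ put $\operatorname{Log} z=\ln|z|+i\arg z$ with $\arg z\in[-\pi,\pi]$ as just described. Then, for every $\epsilon\in(0,2\pi)$, the integral below converges absolutely and $$\log\Gamma(a)=\log\sqrt{2\pi}-\gamma\left(a-\tfrac12\right)+\frac{1}{2\pi i}\int_L\frac{z^{-1}e^{az}\operatorname{Log} z}{1-e^z}\,dz .$$ Moreover, let $\zeta(s,a)$ be the Hurwitz zeta function, that is, the analytic continuation in $s$ to $\mathbb{C}\setminus\{1\}$ (which exists) of $\sum_{n=0}^\infty (n+a)^{-s}$, $\operatorname{Re} s>1$, and put $g(0,a)=\zeta'(0,a)+\psi(1)\zeta(0,a)$,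 where the prime denotes the derivative with respect to $s$. Then $$\log\Gamma(a)=\log\sqrt{2\pi}-\gamma\left(a-\tfrac12\right)+g(0,a).$$ -/

import Mathlib

open MeasureTheory Set

/-! ### The logarithm of the Gamma function on the right half-plane -/

/-- `log Γ(a)` for `Re a > 0`: the primitive of the digamma function `Γ' / Γ` that vanishes at `1`,
computed along the segment from `1` to `a`. It is the holomorphic branch of the logarithm
of `Γ` on the right half-plane which is real on the positive axis; see `hasDerivAt_logGamma`,
`logGamma_one`, `exp_logGamma` and `logGamma_ofReal`. -/
noncomputable def logGamma (a : ℂ) : ℂ :=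
  ∫ t in (0 : ℝ)..1, Complex.digamma (1 + (t : ℂ) * (a - 1)) * (a - 1)

theorem Gamma_ne_zero_of_mem {a : ℂ} (ha : 0 < a.re) : Complex.Gamma a ≠ 0 :=
  Complex.Gamma_ne_zero_of_re_pos ha

theorem differentiableOn_Gamma_halfPlane :
    DifferentiableOn ℂ Complex.Gamma {z : ℂ | 0 < z.re} := by
  intro z hz
  refine (Complex.differentiableAt_Gamma z ?_).differentiableWithinAt
  intro m h
  have h1 : 0 < z.re := hz
  rw [h] at h1
  simp only [Complex.neg_re, Complex.natCast_re] at h1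
  have : (0 : ℝ) ≤ m := Nat.cast_nonneg m
  linarith

theorem differentiableOn_digamma_halfPlane :
    DifferentiableOn ℂ Complex.digamma {z : ℂ | 0 < z.re} := by
  have ho : IsOpen {z : ℂ | 0 < z.re} := isOpen_lt continuous_const Complex.continuous_re
  have h := (differentiableOn_Gamma_halfPlane.deriv ho).div differentiableOn_Gamma_halfPlane
    (fun z hz => Gamma_ne_zero_of_mem hz)
  exact h

theorem segment_mem_halfPlane {a : ℂ} (ha : 0 < a.re) {t : ℝ} (ht : t ∈ Icc (0 : ℝ) 1) :
    0 < (1 + (t : ℂ) * (a - 1)).re := by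
  simp only [Complex.add_re, Complex.one_re, Complex.re_ofReal_mul, Complex.sub_re]
  rcases ht.1.eq_or_lt with h | h
  · rw [← h]; norm_num
  · nlinarith [mul_pos h ha, ht.2]

/-- The logarithm of Gamma is a primitive of the digamma function on the right half-plane. -/
theorem hasDerivAt_logGamma {a : ℂ} (ha : 0 < a.re) :
    HasDerivAt logGamma (Complex.digamma a) a := by
  have ho : IsOpen {z : ℂ | 0 < z.re} := isOpen_lt continuous_const Complex.continuous_re
  have hc : Convex ℝ {z : ℂ | 0 < z.re} := convex_halfSpace_re_gt 0
  obtain ⟨P, hP⟩ := hc.exists_forall_hasDerivWithinAt differentiableOn_digamma_halfPlane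
  have hP' : ∀ z : ℂ, 0 < z.re → HasDerivAt P (Complex.digamma z) z := fun z hz =>
    (hP z hz).hasDerivAt (ho.mem_nhds hz)
  have key : ∀ z : ℂ, 0 < z.re → logGamma z = P z - P 1 := by
    intro z hz
    have hpath : ∀ t : ℝ, HasDerivAt (fun t : ℝ => 1 + (t : ℂ) * (z - 1)) (z - 1) t := by
      intro t
      have h := ((Complex.ofRealCLM.hasDerivAt (x := t)).mul_const (z - 1)).const_add (1 : ℂ)
      simpa using h
    have hcont : Continuous (fun t : ℝ => 1 + (t : ℂ) * (z - 1)) := by fun_prop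
    have h := intervalIntegral.integral_eq_sub_of_hasDerivAt (a := (0 : ℝ)) (b := 1)
      (f := fun t : ℝ => P (1 + (t : ℂ) * (z - 1)))
      (f' := fun t : ℝ => Complex.digamma (1 + (t : ℂ) * (z - 1)) * (z - 1))
      (fun t ht => by
        rw [uIcc_of_le zero_le_one] at ht
        exact (hP' _ (segment_mem_halfPlane hz ht)).comp t (hpath t))
      (by
        apply ContinuousOn.intervalIntegrable
        rw [uIcc_of_le zero_le_one]
        refine ContinuousOn.mul ?_ continuousOn_const
        exact differentiableOn_digamma_halfPlane.continuousOn.comp hcont.continuousOn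
          (fun t ht => segment_mem_halfPlane hz ht))
    rw [logGamma, h]
    simp
  refine ((hP' a ha).sub_const (P 1)).congr_of_eventuallyEq ?_
  filter_upwards [ho.mem_nhds ha] with z hz using key z hz

theorem logGamma_one : logGamma 1 = 0 := by simp [logGamma]

/-- The logarithm of Gamma is a logarithm of Gamma. -/
theorem exp_logGamma {a : ℂ} (ha : 0 < a.re) : Complex.exp (logGamma a) = Complex.Gamma a := by
  have ho : IsOpen {z : ℂ | 0 < z.re} := isOpen_lt continuous_const Complex.continuous_re
  have hc : Convex ℝ {z : ℂ | 0 < z.re} := convex_halfSpace_re_gt 0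
  have hG : ∀ z : ℂ, 0 < z.re → DifferentiableAt ℂ Complex.Gamma z := fun z hz =>
    differentiableOn_Gamma_halfPlane.differentiableAt (ho.mem_nhds hz)
  have hd : ∀ z : ℂ, 0 < z.re →
      HasDerivAt (fun w => Complex.Gamma w * Complex.exp (-logGamma w)) 0 z := by
    intro z hz
    have h := (hG z hz).hasDerivAt.mul (hasDerivAt_logGamma hz).neg.cexp
    have h0 : deriv Complex.Gamma z * Complex.exp (-logGamma z) +
        Complex.Gamma z * (Complex.exp (-logGamma z) * -Complex.digamma z) = 0 := by
      rw [Complex.digamma_def, logDeriv_apply]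
      have := Gamma_ne_zero_of_mem hz
      field_simp
      ring
    exact h0 ▸ h
  have hconst : Complex.Gamma a * Complex.exp (-logGamma a)
      = Complex.Gamma 1 * Complex.exp (-logGamma 1) := by
    refine hc.is_const_of_fderivWithin_eq_zero (𝕜 := ℂ)
      (f := fun w => Complex.Gamma w * Complex.exp (-logGamma w))
      (fun z hz => (hd z hz).differentiableAt.differentiableWithinAt) ?_ ha ?_
    · intro z hz
      rw [fderivWithin_of_isOpen ho hz]
      simpa using (hd z hz).hasFDerivAt.fderiv
    · simp
  rw [logGamma_one, Complex.Gamma_one, Complex.exp_neg] at hconst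
  have := Complex.exp_ne_zero (logGamma a)
  field_simp at hconst
  simpa using hconst.symm

/-- On the positive axis the logarithm of Gamma is the real logarithm of Gamma. -/
theorem logGamma_ofReal {x : ℝ} (hx : 0 < x) :
    logGamma (x : ℂ) = (Real.log (Real.Gamma x) : ℂ) := by
  have hd : ∀ y : ℝ, 0 < y →
      HasDerivAt (fun y : ℝ => logGamma (y : ℂ) - (Real.log (Real.Gamma y) : ℂ)) 0 y := by
    intro y hy
    have hy' : 0 < (y : ℂ).re := by simpa using hy
    have ho : IsOpen {z : ℂ | 0 < z.re} := isOpen_lt continuous_const Complex.continuous_re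
    have hGy := (Real.Gamma_pos_of_pos hy).ne'
    have hR : HasDerivAt Real.Gamma (deriv Real.Gamma y) y :=
      (Real.differentiableAt_Gamma fun m h => by
        have : (0 : ℝ) ≤ m := Nat.cast_nonneg m
        linarith).hasDerivAt
    have hC : HasDerivAt (fun t : ℝ => Complex.Gamma (t : ℂ)) (deriv Complex.Gamma (y : ℂ)) y :=
      (differentiableOn_Gamma_halfPlane.differentiableAt
        (ho.mem_nhds hy')).hasDerivAt.comp_ofReal
    have hR' := hR.ofReal_comp
    have he : deriv Complex.Gamma (y : ℂ) = ((deriv Real.Gamma y : ℝ) : ℂ) := by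
      refine hC.unique ?_
      simpa only [Complex.Gamma_ofReal] using hR'
    have h := (hasDerivAt_logGamma hy').comp_ofReal.sub (hR.log hGy).ofReal_comp
    have h0 : Complex.digamma (y : ℂ) - ((deriv Real.Gamma y / Real.Gamma y : ℝ) : ℂ) = 0 := by
      rw [Complex.digamma_def, logDeriv_apply, he, Complex.Gamma_ofReal]
      simp
    exact h0 ▸ h
  have hconst := (convex_Ioi (0 : ℝ)).is_const_of_fderivWithin_eq_zero (𝕜 := ℝ)
    (f := fun y : ℝ => logGamma (y : ℂ) - (Real.log (Real.Gamma y) : ℂ))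
    (fun y hy => (hd y hy).differentiableAt.differentiableWithinAt)
    (fun y hy => by
      rw [fderivWithin_of_isOpen isOpen_Ioi hy]
      simpa using (hd y hy).hasFDerivAt.fderiv)
    (mem_Ioi.mpr hx) (mem_Ioi.mpr one_pos)
  simp only [Complex.ofReal_one, logGamma_one, Real.Gamma_one, Real.log_one, Complex.ofReal_zero,
    sub_zero] at hconst
  exact sub_eq_zero.mp hconst

/-! ### The Hurwitz zeta function with complex parameter -/

/-- `Z` is the Hurwitz zeta function with parameter `a`: it is given by the series
`∑ 1 / (n + a) ^ s` for `Re s > 1` (powers are principal values) and is holomorphic on `ℂ ∖ {1}`.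
For each `a` this determines `Z` on `ℂ ∖ {1}`, by uniqueness of analytic continuation. -/
def IsHurwitzZeta (a : ℂ) (Z : ℂ → ℂ) : Prop :=
  DifferentiableOn ℂ Z {1}ᶜ ∧
    ∀ s : ℂ, 1 < s.re → HasSum (fun n : ℕ => 1 / ((n : ℂ) + a) ^ s) (Z s)

open scoped Classical in
/-- The Hurwitz zeta function `ζ(s, a)`: the analytic continuation in `s` of
`∑ 1 / (n + a) ^ s`. -/
noncomputable def hurwitzZetaC (s a : ℂ) : ℂ :=
  if h : ∃ Z : ℂ → ℂ, IsHurwitzZeta a Z then h.choose s else 0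

/-- `g(n, a) = ζ'(-n, a) + ψ(n + 1) ζ(-n, a)`, the derivative being taken in the first variable. -/
noncomputable def hurwitzG (n : ℕ) (a : ℂ) : ℂ :=
  deriv (fun s : ℂ => hurwitzZetaC s a) (-(n : ℂ)) +
    Complex.digamma ((n : ℂ) + 1) * hurwitzZetaC (-(n : ℂ)) a

/-! ### Integrals along the Hankel contour

An integrand is a function `F z w` of the point `z` of the contour and of the value `w` of the
logarithm `Log z` there, so that the two sides of the cut along the negative axis are
distinguished: `w = log x - π i` at the point `z = -x` of the lower side, `w = log x + π i`
on the upper side, and `w = log ε + i θ` at the point `z = ε e ^ {i θ}`, `-π ≤ θ ≤ π`,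
of the circle. -/

/-- The integrand on the lower side of the ray, at `z = -x`. -/
noncomputable def hankelLower (F : ℂ → ℂ → ℂ) (x : ℝ) : ℂ :=
  F (-(x : ℂ)) ((Real.log x : ℂ) - Real.pi * Complex.I)

/-- The integrand on the upper side of the ray, at `z = -x`. -/
noncomputable def hankelUpper (F : ℂ → ℂ → ℂ) (x : ℝ) : ℂ :=
  F (-(x : ℂ)) ((Real.log x : ℂ) + Real.pi * Complex.I)

/-- The integrand on the circle, at `z = ε e ^ {i θ}`, multiplied by `dz / dθ`. -/
noncomputable def hankelCircle (ε : ℝ) (F : ℂ → ℂ → ℂ) (θ : ℝ) : ℂ :=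
  F (ε * Complex.exp (θ * Complex.I)) ((Real.log ε : ℂ) + θ * Complex.I) *
    (ε * Complex.exp (θ * Complex.I) * Complex.I)

/-- Absolute integrability on each of the three parts of the Hankel contour of radius `ε`. -/
def HankelIntegrable (ε : ℝ) (F : ℂ → ℂ → ℂ) : Prop :=
  IntegrableOn (hankelLower F) (Ioi ε) ∧
    IntervalIntegrable (hankelCircle ε F) volume (-Real.pi) Real.pi ∧
    IntegrableOn (hankelUpper F) (Ioi ε)

/-- The integral of `F (z, Log z) dz` along the Hankel contour of radius `ε`: the lower side of the
ray `(-∞, -ε)` from left to right, then the circle `|z| = ε` counterclockwise, then the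
upper side of the ray from right to left. With `z = -x` the lower side contributes
`∫_{x = ∞}^{ε} F (-dx) = ∫_ε^∞ F dx`, and the upper side contributes `-∫_ε^∞ F dx`. -/
noncomputable def hankelIntegral (ε : ℝ) (F : ℂ → ℂ → ℂ) : ℂ :=
  (∫ x in Ioi ε, hankelLower F x) + (∫ θ in (-Real.pi)..Real.pi, hankelCircle ε F θ) -
    ∫ x in Ioi ε, hankelUpper F x

/-! Both formulas come from one function of `s`: H(s), the Hankel integral of z^(s-1) e^(az) / (1 -
e^z), which is entire. On the two sides of the cut the powers of z differ only in phase, so the rays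
contribute 2i sin(πs) times a truncated Mellin transform. For Re s > 1 the circle can be shrunk onto
the cut, and H(s) becomes 2i sin(πs) times the full Mellin transform of e^(-ax) / (1 - e^(-x)),
which by the geometric series is Γ(s) ζ(s,a). The reflection formula then gives ζ(s,a) = Γ(1-s) H(s)
/ (2πi), and the right-hand side continues ζ to s ≠ 1 (`hankelTransform_eq_mellin`,
`isHurwitzZeta_hankelZeta`).

At s = 0 the derivative of Γ(1-s) is γ while ψ(1) = -γ, so in g(0,a) the two terms with H(0) cancel
and g(0,a) = H'(0) / (2πi). Differentiating z^s brings down Log z, so this is the integral in the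
theorem (`hurwitzG_zero_eq_hankelIntegral`).

It remains to identify g(0,a) with log Γ (Lerch's formula). By Bohr–Mollerup it suffices that f(x) =
g(0,x) - γx satisfies f(x+1) = f(x) + log x and is convex on x > 0; f(1) is known from ζ(0) and
ζ'(0) of Riemann's function. The recurrence follows from ζ(s,a+1) = ζ(s,a) - a^(-s)
(`hurwitzG_zero_add_one`). Convexity holds because the second derivative of g(0,a) is the integral
over (0,∞) of x e^(-ax) / (1 - e^(-x)), which is nonnegative for real a
(`hasDerivAt_hurwitzGDeriv`). The identity theorem passes from the positive axis to Re a > 0. -/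

/-! ### Identity theorem, and holomorphic dependence of integrals on a parameter -/

theorem eq_of_eq_on_pos_reals {f g : ℂ → ℂ} (hf : DifferentiableOn ℂ f {z : ℂ | 0 < z.re})
    (hg : DifferentiableOn ℂ g {z : ℂ | 0 < z.re}) (h : ∀ x : ℝ, 0 < x → f x = g x)
    {a : ℂ} (ha : 0 < a.re) : f a = g a := by
  have ho : IsOpen {z : ℂ | 0 < z.re} := isOpen_lt continuous_const Complex.continuous_re
  have hc : IsPreconnected {z : ℂ | 0 < z.re} := (convex_halfSpace_re_gt 0).isPreconnected
  refine (hf.analyticOnNhd ho).eqOn_of_preconnected_of_frequently_eq (hg.analyticOnNhd ho) hc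
    (z₀ := 1) (by simp) ?_ ha
  -- The points 1 + 1/(n+1) are positive reals that accumulate at 1 without reaching it.
  have ht : Filter.Tendsto (fun n : ℕ => ((1 + 1 / ((n : ℝ) + 1) : ℝ) : ℂ)) Filter.atTop
      (nhdsWithin 1 {1}ᶜ) := by
    refine tendsto_nhdsWithin_iff.2 ⟨?_, Filter.Eventually.of_forall fun n => ?_⟩
    · have h1 := (tendsto_one_div_add_atTop_nhds_zero_nat (𝕜 := ℝ)).const_add 1
      rw [add_zero] at h1
      have h2 := (Complex.continuous_ofReal.tendsto _).comp h1
      rwa [Complex.ofReal_one] at h2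
    · have : (1 : ℝ) + 1 / ((n : ℝ) + 1) ≠ 1 := by
        have : 0 < 1 / ((n : ℝ) + 1) := by positivity
        linarith
      simpa only [mem_compl_iff, mem_singleton_iff, ← Complex.ofReal_one, Complex.ofReal_inj]
        using this
  exact ht.frequently (Filter.Frequently.of_forall fun n => h _ (by positivity))

/-- A function on `(c, ∞)` whose Laplace transform converges absolutely on the right half-plane. -/
def LaplaceIntegrable (c : ℝ) (m : ℝ → ℂ) : Prop :=
  ∀ b : ℝ, 0 < b → IntegrableOn (fun x : ℝ => Complex.exp (-(b : ℂ) * x) * m x) (Ioi c)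

/-- Half of the exponential absorbs the factor `x`; the other half keeps the decay. -/
theorem mul_exp_neg_mul_le {b x : ℝ} (hb : 0 < b) :
    x * Real.exp (-b * x) ≤ 2 / b * Real.exp (-(b / 2) * x) := by
  have h1 : b / 2 * x ≤ Real.exp (b / 2 * x) := by
    linarith [Real.add_one_le_exp (b / 2 * x)]
  have h2 : Real.exp (-b * x) = Real.exp (-(b / 2) * x) * Real.exp (-(b / 2) * x) := by
    rw [← Real.exp_add]; ring_nf
  have h3 : Real.exp (b / 2 * x) * Real.exp (-(b / 2) * x) = 1 := by
    rw [← Real.exp_add]; ring_nf; simp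
  have hp := Real.exp_pos (-(b / 2) * x)
  have h4 : b / 2 * x * Real.exp (-(b / 2) * x) ≤ 1 := by
    rw [← h3]; gcongr
  have h5 : x * Real.exp (-(b / 2) * x) ≤ 2 / b := by
    rw [le_div_iff₀ hb]; linarith
  rw [h2, ← mul_assoc]
  gcongr

theorem norm_exp_neg_mul (a : ℂ) (x : ℝ) :
    ‖Complex.exp (-a * x)‖ = Real.exp (-a.re * x) := by
  simp [Complex.norm_exp]

theorem LaplaceIntegrable.aestronglyMeasurable {c : ℝ} {m : ℝ → ℂ} (h : LaplaceIntegrable c m) :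
    AEStronglyMeasurable m (volume.restrict (Ioi c)) := by
  have h1 := (h 1 one_pos).aestronglyMeasurable
  have h2 : AEStronglyMeasurable (fun x : ℝ => Complex.exp (x : ℂ)) (volume.restrict (Ioi c)) :=
    (by fun_prop : Continuous fun x : ℝ => Complex.exp (x : ℂ)).aestronglyMeasurable
  refine (h2.mul h1).congr (Filter.Eventually.of_forall fun x => ?_)
  simp only [Pi.mul_apply]
  rw [← mul_assoc, ← Complex.exp_add]
  simp

theorem LaplaceIntegrable.integrableOn {c : ℝ} {m : ℝ → ℂ} (h : LaplaceIntegrable c m)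
    {a : ℂ} (ha : 0 < a.re) : IntegrableOn (fun x : ℝ => Complex.exp (-a * x) * m x) (Ioi c) := by
  refine Integrable.mono (h a.re ha) ?_ (Filter.Eventually.of_forall fun x => ?_)
  · exact (by fun_prop : Continuous fun x : ℝ => Complex.exp (-a * x)).aestronglyMeasurable.mul
      h.aestronglyMeasurable
  · rw [norm_mul, norm_mul, norm_exp_neg_mul, norm_exp_neg_mul, Complex.ofReal_re]

theorem LaplaceIntegrable.mul_id {c : ℝ} (hc : 0 ≤ c) {m : ℝ → ℂ} (h : LaplaceIntegrable c m) :
    LaplaceIntegrable c (fun x => -(x : ℂ) * m x) := by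
  intro b hb
  have h1 := (h (b / 2) (by positivity)).norm.const_mul (2 / b)
  refine h1.mono' ?_ ?_
  · exact (by fun_prop : Continuous fun x : ℝ => Complex.exp (-b * x)).aestronglyMeasurable.mul
      ((by fun_prop : Continuous fun x : ℝ => -(x : ℂ)).aestronglyMeasurable.mul
        h.aestronglyMeasurable)
  · refine (ae_restrict_mem measurableSet_Ioi).mono fun x hx => ?_
    have hx0 : 0 ≤ x := hc.trans (le_of_lt hx)
    rw [norm_mul, norm_mul, norm_mul, norm_exp_neg_mul, norm_exp_neg_mul, norm_neg,
      Complex.norm_real, Real.norm_of_nonneg hx0, Complex.ofReal_re, Complex.ofReal_re]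
    calc Real.exp (-b * x) * (x * ‖m x‖) = (x * Real.exp (-b * x)) * ‖m x‖ := by ring
      _ ≤ (2 / b * Real.exp (-(b / 2) * x)) * ‖m x‖ := by
        gcongr ?_ * _
        exact mul_exp_neg_mul_le hb
      _ = _ := by ring

theorem LaplaceIntegrable.hasDerivAt {c : ℝ} (hc : 0 ≤ c) {m : ℝ → ℂ} (h : LaplaceIntegrable c m)
    {a : ℂ} (ha : 0 < a.re) :
    HasDerivAt (fun a : ℂ => ∫ x in Ioi c, Complex.exp (-a * x) * m x)
      (∫ x in Ioi c, Complex.exp (-a * x) * (-(x : ℂ) * m x)) a := by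
  -- On this neighbourhood of `a` the integrand of the derivative is dominated by its norm at the
  -- real point `a.re / 2`.
  have hs : {z : ℂ | a.re / 2 < z.re} ∈ nhds a :=
    (isOpen_lt continuous_const Complex.continuous_re).mem_nhds (by simp; linarith)
  have hm := h.mul_id hc
  refine (hasDerivAt_integral_of_dominated_loc_of_deriv_le hs ?_ (h.integrableOn ha)
    (μ := volume.restrict (Ioi c))
    (F := fun (a : ℂ) (x : ℝ) => Complex.exp (-a * x) * m x)
    (F' := fun (a : ℂ) (x : ℝ) => Complex.exp (-a * x) * (-(x : ℂ) * m x))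
    (bound := fun x : ℝ => ‖Complex.exp (-((a.re / 2 : ℝ) : ℂ) * x) * (-(x : ℂ) * m x)‖)
    (hm.integrableOn ha).aestronglyMeasurable ?_ (hm (a.re / 2) (by positivity)).norm ?_).2
  · exact Filter.Eventually.of_forall fun z =>
      (by fun_prop : Continuous fun x : ℝ => Complex.exp (-z * x)).aestronglyMeasurable.mul
      h.aestronglyMeasurable
  · refine (ae_restrict_mem measurableSet_Ioi).mono fun x hx z hz => ?_
    have hx0 : 0 ≤ x := hc.trans (le_of_lt hx)
    rw [norm_mul, norm_mul (Complex.exp (-((a.re / 2 : ℝ) : ℂ) * x)), norm_exp_neg_mul,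
      norm_exp_neg_mul, Complex.ofReal_re]
    have hz' : a.re / 2 < z.re := hz
    gcongr
  · refine Filter.Eventually.of_forall fun x z _ => ?_
    have h1 : HasDerivAt (fun a : ℂ => -a * x) (-(x : ℂ)) z := by
      simpa using (hasDerivAt_neg z).mul_const (x : ℂ)
    exact (h1.cexp.mul_const (m x)).congr_deriv (by ring)

theorem hasDerivAt_integral_exp_mul {α β : ℝ} {u k : ℝ → ℂ} (hu : Continuous u)
    (hk : Continuous k) (s : ℂ) :
    HasDerivAt (fun s : ℂ => ∫ θ in α..β, Complex.exp (s * u θ) * k θ)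
      (∫ θ in α..β, Complex.exp (s * u θ) * (u θ * k θ)) s := by
  refine (intervalIntegral.hasDerivAt_integral_of_dominated_loc_of_deriv_le
    (Metric.ball_mem_nhds s one_pos)
    (F' := fun (s : ℂ) (θ : ℝ) => Complex.exp (s * u θ) * (u θ * k θ))
    (bound := fun θ => Real.exp ((‖s‖ + 1) * ‖u θ‖) * (‖u θ‖ * ‖k θ‖)) ?_ ?_ ?_ ?_ ?_ ?_).2
  · exact Filter.Eventually.of_forall fun z =>
      (by fun_prop : Continuous fun θ : ℝ => Complex.exp (z * u θ) * k θ).aestronglyMeasurable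
  · exact (by fun_prop : Continuous fun θ : ℝ =>
      Complex.exp (s * u θ) * k θ).intervalIntegrable _ _
  · exact (by fun_prop : Continuous fun θ : ℝ =>
      Complex.exp (s * u θ) * (u θ * k θ)).aestronglyMeasurable
  · refine Filter.Eventually.of_forall fun θ _ z hz => ?_
    rw [norm_mul, norm_mul]
    gcongr
    refine (Complex.norm_exp_le_exp_norm _).trans ?_
    rw [norm_mul]
    gcongr
    have := norm_sub_norm_le z s
    rw [mem_ball_iff_norm] at hz
    linarith
  · exact (by fun_prop : Continuous fun θ : ℝ =>
      Real.exp ((‖s‖ + 1) * ‖u θ‖) * (‖u θ‖ * ‖k θ‖)).intervalIntegrable _ _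
  · refine Filter.Eventually.of_forall fun θ _ z _ => ?_
    have h1 : HasDerivAt (fun s : ℂ => s * u θ) (u θ) z := by
      simpa using (hasDerivAt_id z).mul_const (u θ)
    exact (h1.cexp.mul_const (k θ)).congr_deriv (by ring)

/-! ### Cauchy's theorem in the logarithmic coordinate -/

/-- Cauchy's theorem on the half strip `Re w ≤ r`, `|Im w| ≤ π`. -/
theorem integral_vertical_eq_integral_Iic {G : ℂ → ℂ} {r C σ : ℝ} (hσ : 0 < σ)
    (hG : ∀ w : ℂ, w.re ≤ r → DifferentiableAt ℂ G w)
    (hb : ∀ w : ℂ, w.re ≤ r → |w.im| ≤ Real.pi → ‖G w‖ ≤ C * Real.exp (σ * w.re)) :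
    Complex.I * ∫ θ in (-Real.pi)..Real.pi, G (r + θ * Complex.I) =
      ∫ u in Iic r, (G (u + Real.pi * Complex.I) - G (u - Real.pi * Complex.I)) := by
  have hpi := Real.pi_pos
  have hcont : ∀ c : ℝ, ContinuousOn (fun u : ℝ => G (u + c * Complex.I)) (Iic r) := by
    intro c u hu
    refine ((hG (u + c * Complex.I) (by simpa using hu)).continuousAt.comp
      (f := fun u : ℝ => (u : ℂ) + c * Complex.I) ?_).continuousWithinAt
    exact (by fun_prop : Continuous fun u : ℝ => (u : ℂ) + c * Complex.I).continuousAt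
  have hexp : IntegrableOn (fun u => C * Real.exp (σ * u)) (Iic r) := by
    exact (integrableOn_exp_mul_Iic hσ r).const_mul C
  have hint : ∀ c : ℝ, |c| ≤ Real.pi →
      IntegrableOn (fun u : ℝ => G (u + c * Complex.I)) (Iic r) := by
    intro c hc
    refine hexp.mono' ((hcont c).aestronglyMeasurable measurableSet_Iic) ?_
    refine (ae_restrict_mem measurableSet_Iic).mono fun u hu => ?_
    simpa using hb (u + c * Complex.I) (by simpa using hu) (by simpa using hc)
  have hpos := hint Real.pi (by rw [abs_of_pos hpi])
  have hneg := hint (-Real.pi) (by rw [abs_neg, abs_of_pos hpi])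
  have hrect : ∀ q : ℝ, q ≤ r →
      (∫ u in q..r, (G (u + (Real.pi : ℝ) * Complex.I) - G (u + ((-Real.pi : ℝ) : ℂ) * Complex.I)))
        = Complex.I * (∫ θ in (-Real.pi)..Real.pi, G (r + θ * Complex.I))
          - Complex.I * (∫ θ in (-Real.pi)..Real.pi, G (q + θ * Complex.I)) := by
    intro q hq
    have h := Complex.integral_boundary_rect_eq_zero_of_differentiableOn G
      ⟨q, -Real.pi⟩ ⟨r, Real.pi⟩ (by
        intro w hw
        rw [Complex.mem_reProdIm, uIcc_of_le hq] at hw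
        exact (hG w hw.1.2).differentiableWithinAt)
    simp only [smul_eq_mul] at h
    rw [intervalIntegral.integral_sub]
    · linear_combination -h
    · exact (intervalIntegrable_iff_integrableOn_Ioc_of_le hq).2
        (hpos.mono_set fun x hx => hx.2)
    · exact (intervalIntegrable_iff_integrableOn_Ioc_of_le hq).2
        (hneg.mono_set fun x hx => hx.2)
  -- The left edge of the rectangle has fixed length 2π, so the exponential bound on `G` makes its
  -- contribution vanish as the edge recedes.
  have hlim0 : Filter.Tendsto (fun q : ℝ =>
      Complex.I * (∫ θ in (-Real.pi)..Real.pi, G (q + θ * Complex.I))) Filter.atBot (nhds 0) := by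
    have hz : Filter.Tendsto (fun q : ℝ => C * Real.exp (σ * q) * |Real.pi - (-Real.pi)|)
        Filter.atBot (nhds 0) := by
      have := (Real.tendsto_exp_atBot.comp
        (Filter.tendsto_id.const_mul_atBot hσ)).const_mul C |>.mul_const (|Real.pi - (-Real.pi)|)
      simpa using this
    refine squeeze_zero_norm' ?_ hz
    filter_upwards [Filter.eventually_le_atBot r] with q hq
    rw [norm_mul, Complex.norm_I, one_mul]
    refine intervalIntegral.norm_integral_le_of_norm_le_const fun θ hθ => ?_
    rw [uIoc_of_le (by linarith)] at hθ
    simpa using hb (q + θ * Complex.I) (by simpa using hq)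
      (by simpa using abs_le.2 ⟨hθ.1.le, hθ.2⟩)
  have h1 := intervalIntegral_tendsto_integral_Iic r (hpos.sub hneg) Filter.tendsto_id
  have h2 : Filter.Tendsto (fun q : ℝ => ∫ u in q..r, (G (u + (Real.pi : ℝ) * Complex.I) -
      G (u + ((-Real.pi : ℝ) : ℂ) * Complex.I))) Filter.atBot
      (nhds (Complex.I * (∫ θ in (-Real.pi)..Real.pi, G (r + θ * Complex.I)))) := by
    have h3 := hlim0.const_sub (Complex.I * (∫ θ in (-Real.pi)..Real.pi, G (r + θ * Complex.I)))
    rw [sub_zero] at h3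
    refine h3.congr' ?_
    filter_upwards [Filter.eventually_le_atBot r] with q hq using (hrect q hq).symm
  have h4 := tendsto_nhds_unique h2 h1
  rw [h4]
  refine setIntegral_congr_fun measurableSet_Iic fun u _ => ?_
  simp [sub_eq_add_neg]

/-- In the coordinate w = log z the slit disc becomes a half strip: the vertical edge is the circle
of radius `ε` and the horizontal edges are the two sides of the cut. The substitution x = e^u brings
the horizontal edges back to (0, ε]. Working in w avoids choosing a branch: `G` may involve w
itself. -/
theorem integral_vertical_eq_integral_Ioc {G : ℂ → ℂ} {ε C σ : ℝ} (hε : 0 < ε) (hσ : 0 < σ)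
    (hG : ∀ w : ℂ, w.re ≤ Real.log ε → DifferentiableAt ℂ G w)
    (hb : ∀ w : ℂ, w.re ≤ Real.log ε → |w.im| ≤ Real.pi → ‖G w‖ ≤ C * Real.exp (σ * w.re)) :
    Complex.I * ∫ θ in (-Real.pi)..Real.pi, G ((Real.log ε : ℂ) + θ * Complex.I) =
      ∫ x in Ioc 0 ε, (x : ℂ)⁻¹ * (G ((Real.log x : ℂ) + Real.pi * Complex.I) -
        G ((Real.log x : ℂ) - Real.pi * Complex.I)) := by
  rw [integral_vertical_eq_integral_Iic hσ hG hb]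
  have himage : Real.exp '' Iic (Real.log ε) = Ioc 0 ε := by
    ext x
    constructor
    · rintro ⟨u, hu, rfl⟩
      exact ⟨Real.exp_pos u, (Real.le_log_iff_exp_le hε).1 hu⟩
    · rintro ⟨h0, h1⟩
      exact ⟨Real.log x, Real.log_le_log h0 h1, Real.exp_log h0⟩
  rw [← himage, integral_image_eq_integral_abs_deriv_smul measurableSet_Iic
    (fun x _ => (Real.hasDerivAt_exp x).hasDerivWithinAt) Real.exp_injective.injOn]
  refine setIntegral_congr_fun measurableSet_Iic fun u _ => ?_
  have hne : ((Real.exp u : ℝ) : ℂ) ≠ 0 := by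
    exact_mod_cast (Real.exp_pos u).ne'
  simp only [Real.log_exp, abs_of_pos (Real.exp_pos u), Complex.real_smul]
  rw [mul_inv_cancel_left₀ hne]

/-! ### The kernel `e^{az} / (1 - e^z)` -/

/-- The kernel `e^{az} / (1 - e^z)`. -/
noncomputable def expKernel (a z : ℂ) : ℂ := Complex.exp (a * z) / (1 - Complex.exp z)

theorem one_sub_exp_ne_zero {z : ℂ} (h0 : z ≠ 0) (h : ‖z‖ < 2 * Real.pi) :
    1 - Complex.exp z ≠ 0 := by
  intro h1
  obtain ⟨n, hn⟩ := Complex.exp_eq_one_iff.1 (sub_eq_zero.1 h1).symm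
  have hn0 : n ≠ 0 := by
    rintro rfl
    simp at hn
    exact h0 hn
  have h2 : (1 : ℝ) ≤ |(n : ℝ)| := by exact_mod_cast Int.one_le_abs hn0
  rw [hn] at h
  simp only [norm_mul, Complex.norm_I, Complex.norm_intCast, Complex.norm_ofNat, Complex.norm_real,
    Real.norm_of_nonneg Real.pi_pos.le, mul_one] at h
  nlinarith [Real.pi_pos]

theorem one_sub_exp_neg_pos {x : ℝ} (hx : 0 < x) : 0 < 1 - Real.exp (-x) := by
  have : Real.exp (-x) < 1 := Real.exp_lt_one_iff.2 (by linarith)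
  linarith

theorem one_sub_exp_neg_ofReal_ne_zero {x : ℝ} (hx : 0 < x) :
    1 - Complex.exp (-(x : ℂ)) ≠ 0 := by
  have := (one_sub_exp_neg_pos hx).ne'
  exact_mod_cast this

theorem differentiableAt_expKernel (a : ℂ) {z : ℂ} (h : 1 - Complex.exp z ≠ 0) :
    DifferentiableAt ℂ (expKernel a) z := by
  unfold expKernel
  exact DifferentiableAt.div (by fun_prop) (by fun_prop) h

/-- The only pole in the disc is the simple one at 0: (e^z - 1)/z extends to an entire function,
here `dslope`, without zeros on the closed disc, and compactness bounds the remaining quotient. -/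
theorem exists_norm_expKernel_le (a : ℂ) {ε : ℝ} (hε : ε < 2 * Real.pi) :
    ∃ C : ℝ, ∀ z : ℂ, z ≠ 0 → ‖z‖ ≤ ε → ‖expKernel a z‖ ≤ C * ‖z‖⁻¹ := by
  have hd : Differentiable ℂ (dslope Complex.exp 0) := by
    have h := (Complex.differentiableOn_dslope (s := univ) (f := Complex.exp)
      (c := 0) Filter.univ_mem).2 Complex.differentiable_exp.differentiableOn
    exact differentiableOn_univ.1 h
  have hv : ∀ z : ℂ, z ≠ 0 → dslope Complex.exp 0 z = (Complex.exp z - 1) / z := by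
    intro z hz
    rw [dslope_of_ne _ hz, slope_def_field]
    simp
  have hne : ∀ z ∈ Metric.closedBall (0 : ℂ) ε, dslope Complex.exp 0 z ≠ 0 := by
    intro z hz
    rcases eq_or_ne z 0 with rfl | h0
    · simp [dslope_same]
    · rw [hv z h0]
      have := one_sub_exp_ne_zero h0 ((mem_closedBall_zero_iff.1 hz).trans_lt hε)
      refine div_ne_zero (fun h => this ?_) h0
      linear_combination -h
  have hc : ContinuousOn (fun z => Complex.exp (a * z) / dslope Complex.exp 0 z)
      (Metric.closedBall 0 ε) :=
    ContinuousOn.div (by fun_prop) hd.continuous.continuousOn hne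
  obtain ⟨C, hC⟩ := (isCompact_closedBall (0 : ℂ) ε).exists_bound_of_continuousOn hc
  refine ⟨C, fun z h0 hz => ?_⟩
  have h1 := hC z (mem_closedBall_zero_iff.2 hz)
  have h2 : expKernel a z = -(Complex.exp (a * z) / dslope Complex.exp 0 z) * z⁻¹ := by
    rw [hv z h0, expKernel, ← neg_sub (Complex.exp z)]
    have h3 : Complex.exp z - 1 ≠ 0 := by
      have := one_sub_exp_ne_zero h0 (hz.trans_lt hε)
      intro h
      exact this (by linear_combination -h)
    field_simp
  rw [h2, norm_mul, norm_neg, norm_inv]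
  gcongr

theorem expKernel_neg_ofReal (a : ℂ) (x : ℝ) :
    expKernel a (-(x : ℂ)) = Complex.exp (-a * x) * (1 - Complex.exp (-(x : ℂ)))⁻¹ := by
  rw [expKernel, div_eq_mul_inv, mul_neg, neg_mul]

theorem norm_inv_one_sub_exp_neg {x : ℝ} (hx : 0 < x) :
    ‖(1 - Complex.exp (-(x : ℂ)))⁻¹‖ = (1 - Real.exp (-x))⁻¹ := by
  have h := one_sub_exp_neg_pos hx
  have : (1 - Complex.exp (-(x : ℂ)))⁻¹ = (((1 - Real.exp (-x))⁻¹ : ℝ) : ℂ) := by push_cast; rfl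
  rw [this, Complex.norm_real, Real.norm_of_nonneg (inv_nonneg.2 h.le)]

theorem continuousOn_inv_one_sub_exp_neg :
    ContinuousOn (fun x : ℝ => (1 - Complex.exp (-(x : ℂ)))⁻¹) (Ioi 0) :=
  ContinuousOn.inv₀ (by fun_prop) fun _ hx => one_sub_exp_neg_ofReal_ne_zero hx

theorem mul_inv_one_sub_exp_neg_le {x : ℝ} (hx : 0 < x) :
    x * (1 - Real.exp (-x))⁻¹ ≤ 1 + x := by
  have h := one_sub_exp_neg_pos hx
  rw [← div_eq_mul_inv, div_le_iff₀ h]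
  have h1 : (1 + x) * Real.exp (-x) ≤ 1 := by
    calc (1 + x) * Real.exp (-x) ≤ Real.exp x * Real.exp (-x) := by
          gcongr; linarith [Real.add_one_le_exp x]
      _ = 1 := by rw [← Real.exp_add]; simp
  linarith

theorem inv_one_sub_exp_neg_le {ε x : ℝ} (hε : 0 < ε) (hx : ε ≤ x) :
    (1 - Real.exp (-x))⁻¹ ≤ (1 - Real.exp (-ε))⁻¹ := by
  have := one_sub_exp_neg_pos hε
  gcongr

theorem laplaceIntegrable_of_norm_le {c A B : ℝ} (hc : 0 ≤ c) {m : ℝ → ℂ}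
    (hm : ContinuousOn m (Ioi c)) (h : ∀ x, c < x → ‖m x‖ ≤ A + B * x) : LaplaceIntegrable c m := by
  intro b hb
  have h1 : IntegrableOn (fun x : ℝ => Real.exp (-b * x)) (Ioi c) :=
    exp_neg_integrableOn_Ioi c hb
  have h2 : IntegrableOn (fun x : ℝ => x * Real.exp (-b * x)) (Ioi c) := by
    refine Integrable.mono' ((exp_neg_integrableOn_Ioi c (half_pos hb)).const_mul (2 / b))
      (by fun_prop : Continuous fun x : ℝ => x * Real.exp (-b * x)).aestronglyMeasurable ?_
    refine (ae_restrict_mem measurableSet_Ioi).mono fun x hx => ?_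
    have hx0 : 0 ≤ x := hc.trans (le_of_lt hx)
    rw [Real.norm_of_nonneg (by positivity)]
    exact mul_exp_neg_mul_le hb
  refine Integrable.mono' ((h1.const_mul A).add (h2.const_mul B)) ?_ ?_
  · exact (by fun_prop : Continuous fun x : ℝ => Complex.exp (-b * x)).aestronglyMeasurable.mul
      (hm.aestronglyMeasurable measurableSet_Ioi)
  · refine (ae_restrict_mem measurableSet_Ioi).mono fun x hx => ?_
    rw [norm_mul, norm_exp_neg_mul, Complex.ofReal_re]
    calc Real.exp (-b * x) * ‖m x‖ ≤ Real.exp (-b * x) * (A + B * x) := by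
          gcongr; exact h x hx
      _ = _ := by simp only [Pi.add_apply]; ring

theorem laplaceIntegrable_inv_one_sub_exp_neg {ε : ℝ} (hε : 0 < ε) :
    LaplaceIntegrable ε (fun x : ℝ => (1 - Complex.exp (-(x : ℂ)))⁻¹) := by
  refine laplaceIntegrable_of_norm_le (A := (1 - Real.exp (-ε))⁻¹) (B := 0) hε.le
    (continuousOn_inv_one_sub_exp_neg.mono (Ioi_subset_Ioi hε.le)) fun x hx => ?_
  rw [norm_inv_one_sub_exp_neg (hε.trans hx), zero_mul, add_zero]
  exact inv_one_sub_exp_neg_le hε hx.le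

theorem laplaceIntegrable_mul_inv_one_sub_exp_neg :
    LaplaceIntegrable 0 (fun x : ℝ => (x : ℂ) * (1 - Complex.exp (-(x : ℂ)))⁻¹) := by
  refine laplaceIntegrable_of_norm_le (A := 1) (B := 1) le_rfl
    (ContinuousOn.mul (by fun_prop) continuousOn_inv_one_sub_exp_neg) fun x hx => ?_
  rw [norm_mul, norm_inv_one_sub_exp_neg hx, Complex.norm_real, Real.norm_of_nonneg hx.le, one_mul]
  exact mul_inv_one_sub_exp_neg_le hx

theorem laplaceIntegrable_inv_mul_inv_one_sub_exp_neg {ε : ℝ} (hε : 0 < ε) :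
    LaplaceIntegrable ε (fun x : ℝ => (x : ℂ)⁻¹ * (1 - Complex.exp (-(x : ℂ)))⁻¹) := by
  refine laplaceIntegrable_of_norm_le (A := ε⁻¹ * (1 - Real.exp (-ε))⁻¹) (B := 0) hε.le
    (ContinuousOn.mul (ContinuousOn.inv₀ (by fun_prop) fun x hx => ?_)
    (continuousOn_inv_one_sub_exp_neg.mono (Ioi_subset_Ioi hε.le))) fun x hx => ?_
  · exact_mod_cast (hε.trans hx).ne'
  · have hx0 := hε.trans hx
    rw [norm_mul, norm_inv_one_sub_exp_neg hx0, norm_inv, Complex.norm_real,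
      Real.norm_of_nonneg hx0.le, zero_mul, add_zero]
    have := one_sub_exp_neg_pos hε
    have := (one_sub_exp_neg_pos hx0).le
    gcongr

theorem laplaceIntegrable_log_mul {ε : ℝ} (hε : 0 < ε) (c : ℂ) :
    LaplaceIntegrable ε (fun x : ℝ => ((Real.log x : ℂ) + c) *
      ((x : ℂ)⁻¹ * (1 - Complex.exp (-(x : ℂ)))⁻¹)) := by
  have hM : 0 < ε⁻¹ * (1 - Real.exp (-ε))⁻¹ := by
    have := one_sub_exp_neg_pos hε
    positivity
  refine laplaceIntegrable_of_norm_le (A := (|Real.log ε| + ‖c‖) * (ε⁻¹ * (1 - Real.exp (-ε))⁻¹))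
    (B := ε⁻¹ * (1 - Real.exp (-ε))⁻¹) hε.le
    (ContinuousOn.mul ?_ (ContinuousOn.mul (ContinuousOn.inv₀ (by fun_prop) fun x hx => ?_)
    (continuousOn_inv_one_sub_exp_neg.mono (Ioi_subset_Ioi hε.le)))) fun x hx => ?_
  · refine ContinuousOn.add (Complex.continuous_ofReal.comp_continuousOn
      (Real.continuousOn_log.mono fun x hx => ?_)) continuousOn_const
    exact (hε.trans hx).ne'
  · exact_mod_cast (hε.trans hx).ne'
  · have hx0 := hε.trans hx
    rw [norm_mul, norm_mul, norm_inv_one_sub_exp_neg hx0, norm_inv, Complex.norm_real,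
      Real.norm_of_nonneg hx0.le]
    have h1 : ‖(Real.log x : ℂ) + c‖ ≤ |Real.log ε| + ‖c‖ + x := by
      refine (norm_add_le _ _).trans ?_
      rw [Complex.norm_real, Real.norm_eq_abs]
      have h2 := Real.log_le_log hε hx.le
      have h3 := (Real.log_le_sub_one_of_pos hx0)
      have h4 : |Real.log x| ≤ |Real.log ε| + x := by
        rw [abs_le]
        have := neg_abs_le (Real.log ε)
        have := abs_nonneg (Real.log ε)
        constructor <;> linarith
      linarith
    have h2 : x⁻¹ * (1 - Real.exp (-x))⁻¹ ≤ ε⁻¹ * (1 - Real.exp (-ε))⁻¹ := by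
      have := one_sub_exp_neg_pos hε
      have := (one_sub_exp_neg_pos hx0).le
      gcongr
    have h3 : 0 ≤ x⁻¹ * (1 - Real.exp (-x))⁻¹ := by
      have := one_sub_exp_neg_pos hx0
      positivity
    calc _ ≤ (|Real.log ε| + ‖c‖ + x) * (ε⁻¹ * (1 - Real.exp (-ε))⁻¹) := by gcongr
      _ = _ := by ring

/-! ### The Dirichlet series as a Mellin transform -/

theorem laplaceIntegrable_cpow {s : ℂ} (hs : 0 < s.re) :
    LaplaceIntegrable 0 (fun x : ℝ => (x : ℂ) ^ (s - 1)) := by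
  intro b hb
  have h1 : IntegrableOn (fun x : ℝ => x ^ (s.re - 1) * Real.exp (-(b * x))) (Ioi 0) := by
    -- A non-integrable function would have integral 0, while the known value is a positive multiple
    -- of a Gamma value.
    by_contra h
    have h2 := Real.integral_rpow_mul_exp_neg_mul_Ioi hs hb
    rw [integral_undef h] at h2
    have : 0 < (1 / b) ^ s.re * Real.Gamma s.re := by
      have := Real.Gamma_pos_of_pos hs
      positivity
    linarith
  refine Integrable.mono' h1 ?_ ?_
  · refine (ContinuousOn.mul (by fun_prop) ?_).aestronglyMeasurable measurableSet_Ioi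
    exact ContinuousOn.cpow_const (by fun_prop) fun x hx => Complex.ofReal_mem_slitPlane.2 hx
  · refine (ae_restrict_mem measurableSet_Ioi).mono fun x hx => ?_
    rw [norm_mul, norm_exp_neg_mul, Complex.norm_cpow_eq_rpow_re_of_pos hx, Complex.ofReal_re,
      Complex.sub_re, Complex.one_re, mul_comm, neg_mul]

/-- For real a > 0 this is Euler's integral; both sides are holomorphic in `a`, so the identity
theorem extends it. -/
theorem integral_exp_neg_mul_cpow {s : ℂ} (hs : 0 < s.re) {a : ℂ} (ha : 0 < a.re) :
    ∫ x in Ioi (0 : ℝ), Complex.exp (-a * x) * (x : ℂ) ^ (s - 1) =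
      1 / a ^ s * Complex.Gamma s := by
  refine eq_of_eq_on_pos_reals
    (f := fun a => ∫ x in Ioi (0 : ℝ), Complex.exp (-a * x) * (x : ℂ) ^ (s - 1))
    (g := fun a => 1 / a ^ s * Complex.Gamma s) ?_ ?_ ?_ ha
  · exact fun z hz =>
      ((laplaceIntegrable_cpow hs).hasDerivAt le_rfl hz).differentiableAt.differentiableWithinAt
  · intro z hz
    have hz0 : z ≠ 0 := by
      rintro rfl
      simp at hz
    refine DifferentiableAt.differentiableWithinAt ?_
    refine DifferentiableAt.mul_const (DifferentiableAt.div (by fun_prop) ?_ ?_) _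
    · exact (differentiableAt_id).cpow_const (Or.inl hz)
    · simp [Complex.cpow_eq_zero_iff, hz0]
  · intro x hx
    have h := Complex.integral_cpow_mul_exp_neg_mul_Ioi hs hx
    rw [one_div, Complex.inv_cpow _ _ (by
      rw [Complex.arg_ofReal_of_nonneg hx.le]; exact Real.pi_pos.ne)] at h
    rw [one_div, ← h]
    refine setIntegral_congr_fun measurableSet_Ioi fun y _ => ?_
    rw [mul_comm, neg_mul]

/-- Expand 1/(1 - e^(-x)) as a geometric series and integrate termwise. The norms of the terms
integrate to Γ(Re s) / (n + Re a)^(Re s), which is summable for Re s > 1. -/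
theorem hasSum_one_div_cpow {a s : ℂ} (ha : 0 < a.re) (hs : 1 < s.re) :
    HasSum (fun n : ℕ => 1 / ((n : ℂ) + a) ^ s * Complex.Gamma s)
      (mellin (fun x : ℝ => expKernel a (-(x : ℂ))) s) := by
  have hs0 : 0 < s.re := by linarith
  have hna : ∀ n : ℕ, 0 < ((n : ℂ) + a).re := fun n => by
    simp only [Complex.add_re, Complex.natCast_re]
    positivity
  have hint : ∀ n : ℕ, IntegrableOn
      (fun x : ℝ => Complex.exp (-((n : ℂ) + a) * x) * (x : ℂ) ^ (s - 1)) (Ioi 0) :=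
    fun n => (laplaceIntegrable_cpow hs0).integrableOn (hna n)
  have hnorm : ∀ n : ℕ, ∫ x in Ioi (0 : ℝ),
      ‖Complex.exp (-((n : ℂ) + a) * x) * (x : ℂ) ^ (s - 1)‖ =
        1 / |(n : ℝ) + a.re| ^ s.re * Real.Gamma s.re := by
    intro n
    have hp : 0 < (n : ℝ) + a.re := by simpa using hna n
    rw [abs_of_pos hp, ← Real.one_rpow s.re, ← Real.div_rpow zero_le_one hp.le,
      ← Real.integral_rpow_mul_exp_neg_mul_Ioi hs0 hp]
    refine setIntegral_congr_fun measurableSet_Ioi fun x hx => ?_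
    rw [norm_mul, norm_exp_neg_mul, Complex.norm_cpow_eq_rpow_re_of_pos hx, Complex.sub_re,
      Complex.one_re, mul_comm, neg_mul]
    simp
  have hsum : Summable fun n : ℕ => ∫ x in Ioi (0 : ℝ),
      ‖Complex.exp (-((n : ℂ) + a) * x) * (x : ℂ) ^ (s - 1)‖ := by
    simp_rw [hnorm]
    exact ((Real.summable_one_div_nat_add_rpow a.re s.re).2 hs).mul_right _
  have h := hasSum_integral_of_summable_integral_norm hint hsum
  simp_rw [integral_exp_neg_mul_cpow hs0 (hna _)] at h
  suffices he : mellin (fun x : ℝ => expKernel a (-(x : ℂ))) s = ∫ x in Ioi (0 : ℝ),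
      ∑' n : ℕ, Complex.exp (-((n : ℂ) + a) * x) * (x : ℂ) ^ (s - 1) by
    rwa [he]
  rw [mellin]
  refine setIntegral_congr_fun measurableSet_Ioi fun x hx => ?_
  have hlt : ‖Complex.exp (-(x : ℂ))‖ < 1 := by
    rw [Complex.norm_exp]
    simpa using hx
  have hg := (hasSum_geometric_of_norm_lt_one hlt).mul_left
    (Complex.exp (-a * x) * (x : ℂ) ^ (s - 1))
  rw [expKernel_neg_ofReal, smul_eq_mul]
  trans Complex.exp (-a * x) * (x : ℂ) ^ (s - 1) * (1 - Complex.exp (-(x : ℂ)))⁻¹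
  · ring
  · rw [← hg.tsum_eq]
    refine tsum_congr fun n => ?_
    rw [← Complex.exp_nat_mul, mul_right_comm, ← Complex.exp_add]
    congr 2
    ring

/-! ### The Hankel integral as an entire function of `s` -/

theorem exp_log_add_mul_I {ε : ℝ} (hε : 0 < ε) (θ : ℂ) :
    Complex.exp ((Real.log ε : ℂ) + θ * Complex.I) = ε * Complex.exp (θ * Complex.I) := by
  rw [Complex.exp_add, ← Complex.ofReal_exp, Real.exp_log hε]

theorem exp_log_add_pi_mul_I {x : ℝ} (hx : 0 < x) :
    Complex.exp ((Real.log x : ℂ) + Real.pi * Complex.I) = -(x : ℂ) := by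
  rw [exp_log_add_mul_I hx, Complex.exp_pi_mul_I, mul_neg_one]

theorem exp_log_sub_pi_mul_I {x : ℝ} (hx : 0 < x) :
    Complex.exp ((Real.log x : ℂ) - Real.pi * Complex.I) = -(x : ℂ) := by
  have := exp_log_add_mul_I hx (-(Real.pi : ℂ))
  rw [neg_mul, ← sub_eq_add_neg] at this
  rw [this, Complex.exp_neg, Complex.exp_pi_mul_I]
  norm_num

theorem norm_ofReal_mul_exp_mul_I {ε : ℝ} (hε : 0 < ε) (θ : ℝ) :
    ‖(ε : ℂ) * Complex.exp (θ * Complex.I)‖ = ε := by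
  rw [norm_mul, Complex.norm_exp_ofReal_mul_I, Complex.norm_real, Real.norm_of_nonneg hε.le,
    mul_one]

theorem one_sub_exp_circle_ne_zero {ε : ℝ} (hε : 0 < ε) (hε' : ε < 2 * Real.pi) (θ : ℝ) :
    1 - Complex.exp (ε * Complex.exp (θ * Complex.I)) ≠ 0 := by
  have hn := norm_ofReal_mul_exp_mul_I hε θ
  refine one_sub_exp_ne_zero (fun h => ?_) (by rwa [hn])
  rw [h, norm_zero] at hn
  exact hε.ne hn

theorem continuous_expKernel_circle (a : ℂ) {ε : ℝ} (hε : 0 < ε) (hε' : ε < 2 * Real.pi) :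
    Continuous fun θ : ℝ => expKernel a (ε * Complex.exp (θ * Complex.I)) :=
  Continuous.div (by fun_prop) (by fun_prop) (one_sub_exp_circle_ne_zero hε hε')

theorem integrableOn_expKernel_neg {a : ℂ} (ha : 0 < a.re) {ε : ℝ} (hε : 0 < ε) :
    IntegrableOn (fun x : ℝ => expKernel a (-(x : ℂ))) (Ioi ε) := by
  simp_rw [expKernel_neg_ofReal]
  exact (laplaceIntegrable_inv_one_sub_exp_neg hε).integrableOn ha

theorem expKernel_neg_isBigO_atTop (a : ℂ) :
    (fun x : ℝ => expKernel a (-(x : ℂ))) =O[Filter.atTop] fun x => Real.exp (-a.re * x) := by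
  refine Asymptotics.IsBigO.of_bound ((1 - Real.exp (-1))⁻¹) ?_
  filter_upwards [Filter.eventually_ge_atTop (1 : ℝ)] with x hx
  rw [expKernel_neg_ofReal, norm_mul, norm_exp_neg_mul, norm_inv_one_sub_exp_neg (by linarith),
    Real.norm_of_nonneg (Real.exp_pos _).le, mul_comm]
  exact mul_le_mul_of_nonneg_right (inv_one_sub_exp_neg_le one_pos hx) (Real.exp_pos _).le

theorem expKernel_neg_isBigO_zero {a : ℂ} (ha : 0 < a.re) :
    (fun x : ℝ => expKernel a (-(x : ℂ))) =O[nhdsWithin 0 (Ioi 0)] fun x => x ^ (-(1 : ℝ)) := by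
  refine Asymptotics.IsBigO.of_bound 2 ?_
  filter_upwards [Ioo_mem_nhdsGT one_pos] with x hx
  have hx0 : 0 < x := hx.1
  rw [expKernel_neg_ofReal, norm_mul, norm_exp_neg_mul, norm_inv_one_sub_exp_neg hx0,
    Real.rpow_neg_one, Real.norm_of_nonneg (inv_nonneg.2 hx0.le)]
  have h1 : Real.exp (-a.re * x) ≤ 1 := Real.exp_le_one_iff.2 (by nlinarith)
  have h2 := mul_inv_one_sub_exp_neg_le hx0
  have h3 : (1 - Real.exp (-x))⁻¹ ≤ 2 * x⁻¹ := by
    rw [← div_eq_mul_inv, le_div_iff₀ hx0]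
    linarith [hx.2]
  have h4 := (inv_pos.2 (one_sub_exp_neg_pos hx0)).le
  calc _ ≤ 1 * (1 - Real.exp (-x))⁻¹ := by gcongr
    _ ≤ _ := by linarith

theorem continuousOn_expKernel_neg (a : ℂ) :
    ContinuousOn (fun x : ℝ => expKernel a (-(x : ℂ))) (Ioi 0) := by
  simp_rw [expKernel_neg_ofReal]
  exact ContinuousOn.mul (by fun_prop) continuousOn_inv_one_sub_exp_neg

theorem mellinConvergent_expKernel_neg {a s : ℂ} (ha : 0 < a.re) (hs : 1 < s.re) :
    MellinConvergent (fun x : ℝ => expKernel a (-(x : ℂ))) s :=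
  mellinConvergent_of_isBigO_rpow_exp ha
    ((continuousOn_expKernel_neg a).locallyIntegrableOn measurableSet_Ioi)
    (expKernel_neg_isBigO_atTop a) (expKernel_neg_isBigO_zero ha) hs

theorem differentiableAt_mellin_expKernel_neg {a s : ℂ} (ha : 0 < a.re) (hs : 1 < s.re) :
    DifferentiableAt ℂ (mellin (fun x : ℝ => expKernel a (-(x : ℂ)))) s :=
  mellin_differentiableAt_of_isBigO_rpow_exp ha
    ((continuousOn_expKernel_neg a).locallyIntegrableOn measurableSet_Ioi)
    (expKernel_neg_isBigO_atTop a) (expKernel_neg_isBigO_zero ha) hs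

/-- Cutting off at `ε` removes the singularity at 0, the only obstruction to convergence for all
`s`. -/
theorem differentiable_mellin_indicator_expKernel_neg {a : ℂ} (ha : 0 < a.re) {ε : ℝ}
    (hε : 0 < ε) :
    Differentiable ℂ (mellin ((Ioi ε).indicator fun x : ℝ => expKernel a (-(x : ℂ)))) := by
  intro s
  refine mellin_differentiableAt_of_isBigO_rpow_exp ha (b := s.re - 1) ?_ ?_ ?_ (by linarith)
  · exact ((integrable_indicator_iff measurableSet_Ioi).2
      (integrableOn_expKernel_neg ha hε)).locallyIntegrable.locallyIntegrableOn _
  · refine Asymptotics.IsBigO.trans (Asymptotics.IsBigO.of_bound 1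
      (Filter.Eventually.of_forall fun x => ?_)) (expKernel_neg_isBigO_atTop a)
    rw [one_mul]
    exact norm_indicator_le_norm_self _ _
  · refine Asymptotics.IsBigO.of_bound 0 ?_
    filter_upwards [Ioo_mem_nhdsGT hε] with x hx
    rw [indicator_of_notMem (notMem_Ioi.2 hx.2.le)]
    simp

theorem mellin_indicator_Ioi {f : ℝ → ℂ} {ε : ℝ} (hε : 0 < ε) (s : ℂ) :
    mellin ((Ioi ε).indicator f) s = ∫ x in Ioi ε, (x : ℂ) ^ (s - 1) * f x := by
  have h : ∀ x : ℝ, (x : ℂ) ^ (s - 1) • (Ioi ε).indicator f x =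
      (Ioi ε).indicator (fun x : ℝ => (x : ℂ) ^ (s - 1) * f x) x := by
    intro x
    by_cases hx : x ∈ Ioi ε <;> simp [hx]
  simp_rw [mellin, h]
  rw [setIntegral_indicator measurableSet_Ioi,
    inter_eq_right.2 (Ioi_subset_Ioi hε.le)]

/-- The integral of `z ^ (s - 1) e ^ (a z) / (1 - e ^ z)` along the Hankel contour. -/
noncomputable def hankelTransform (ε : ℝ) (a s : ℂ) : ℂ :=
  2 * Complex.I * Complex.sin (Real.pi * s) *
      mellin ((Ioi ε).indicator fun x : ℝ => expKernel a (-(x : ℂ))) s +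
    ∫ θ in (-Real.pi)..Real.pi, Complex.exp (s * ((Real.log ε : ℂ) + θ * Complex.I)) *
      (Complex.I * expKernel a (ε * Complex.exp (θ * Complex.I)))

/-- The integrand of the Hankel integral for `log Γ`. -/
noncomputable def logGammaIntegrand (a z w : ℂ) : ℂ :=
  z⁻¹ * Complex.exp (a * z) * w / (1 - Complex.exp z)

theorem logGammaIntegrand_eq (a z w : ℂ) :
    logGammaIntegrand a z w = w * z⁻¹ * expKernel a z := by
  rw [logGammaIntegrand, expKernel]; ring

theorem hankelCircle_logGammaIntegrand (a : ℂ) {ε : ℝ} (hε : 0 < ε) (θ : ℝ) :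
    hankelCircle ε (logGammaIntegrand a) θ = ((Real.log ε : ℂ) + θ * Complex.I) *
      (Complex.I * expKernel a (ε * Complex.exp (θ * Complex.I))) := by
  rw [hankelCircle, logGammaIntegrand_eq]
  have h1 : (ε : ℂ) ≠ 0 := by exact_mod_cast hε.ne'
  have h2 := Complex.exp_ne_zero (θ * Complex.I)
  field_simp

theorem hankelLower_logGammaIntegrand (a : ℂ) (x : ℝ) :
    hankelLower (logGammaIntegrand a) x = -(Complex.exp (-a * x) *
      (((Real.log x : ℂ) + -(Real.pi * Complex.I)) *
        ((x : ℂ)⁻¹ * (1 - Complex.exp (-(x : ℂ)))⁻¹))) := by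
  rw [hankelLower, logGammaIntegrand_eq, expKernel_neg_ofReal, inv_neg]; ring

theorem hankelUpper_logGammaIntegrand (a : ℂ) (x : ℝ) :
    hankelUpper (logGammaIntegrand a) x = -(Complex.exp (-a * x) *
      (((Real.log x : ℂ) + Real.pi * Complex.I) *
        ((x : ℂ)⁻¹ * (1 - Complex.exp (-(x : ℂ)))⁻¹))) := by
  rw [hankelUpper, logGammaIntegrand_eq, expKernel_neg_ofReal, inv_neg]; ring

theorem hankelIntegrable_logGammaIntegrand {a : ℂ} (ha : 0 < a.re) {ε : ℝ} (hε : 0 < ε)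
    (hε' : ε < 2 * Real.pi) : HankelIntegrable ε (logGammaIntegrand a) := by
  refine ⟨?_, ?_, ?_⟩
  · simp_rw [funext (hankelLower_logGammaIntegrand a)]
    exact ((laplaceIntegrable_log_mul hε _).integrableOn ha).neg
  · simp_rw [funext (hankelCircle_logGammaIntegrand a hε)]
    have := continuous_expKernel_circle a hε hε'
    exact (by fun_prop : Continuous _).intervalIntegrable _ _
  · simp_rw [funext (hankelUpper_logGammaIntegrand a)]
    exact ((laplaceIntegrable_log_mul hε _).integrableOn ha).neg

/-- The rays are traced in opposite directions, so only the jump 2πi of Log z across the cut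
survives on them. -/
theorem hankelIntegral_logGammaIntegrand {a : ℂ} (ha : 0 < a.re) {ε : ℝ} (hε : 0 < ε)
    (hε' : ε < 2 * Real.pi) :
    hankelIntegral ε (logGammaIntegrand a) =
      2 * Real.pi * Complex.I * (∫ x in Ioi ε, Complex.exp (-a * x) *
        ((x : ℂ)⁻¹ * (1 - Complex.exp (-(x : ℂ)))⁻¹)) +
      ∫ θ in (-Real.pi)..Real.pi, ((Real.log ε : ℂ) + θ * Complex.I) *
        (Complex.I * expKernel a (ε * Complex.exp (θ * Complex.I))) := by
  obtain ⟨h1, -, h3⟩ := hankelIntegrable_logGammaIntegrand ha hε hε'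
  rw [hankelIntegral, add_sub_right_comm, ← integral_sub h1 h3, ← integral_const_mul,
    funext (hankelCircle_logGammaIntegrand a hε)]
  congr 1
  refine setIntegral_congr_fun measurableSet_Ioi fun x _ => ?_
  simp only [hankelLower_logGammaIntegrand, hankelUpper_logGammaIntegrand]
  ring

theorem differentiable_hankelTransform {a : ℂ} (ha : 0 < a.re) {ε : ℝ} (hε : 0 < ε)
    (hε' : ε < 2 * Real.pi) : Differentiable ℂ (hankelTransform ε a) := by
  intro s
  have := continuous_expKernel_circle a hε hε'
  refine DifferentiableAt.add (DifferentiableAt.mul (by fun_prop)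
    (differentiable_mellin_indicator_expKernel_neg ha hε s)) ?_
  exact (hasDerivAt_integral_exp_mul (by fun_prop) (by fun_prop) s).differentiableAt

/-- The sine vanishes at 0, so on the rays only its derivative counts and gives the factor 2πi; on
the circle differentiating e^(sw) brings down w = Log z. -/
theorem hasDerivAt_hankelTransform_zero {a : ℂ} (ha : 0 < a.re) {ε : ℝ} (hε : 0 < ε)
    (hε' : ε < 2 * Real.pi) :
    HasDerivAt (hankelTransform ε a) (hankelIntegral ε (logGammaIntegrand a)) 0 := by
  have hc := continuous_expKernel_circle a hε hε'
  have h1 := (differentiable_mellin_indicator_expKernel_neg ha hε 0).hasDerivAt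
  have h2 : HasDerivAt (fun s : ℂ => 2 * Complex.I * Complex.sin (Real.pi * s))
      (2 * Real.pi * Complex.I) 0 := by
    have h3 := ((hasDerivAt_id (0 : ℂ)).const_mul (Real.pi : ℂ)).csin.const_mul (2 * Complex.I)
    refine h3.congr_deriv ?_
    simp
    ring
  have h4 := hasDerivAt_integral_exp_mul (α := -Real.pi) (β := Real.pi)
    (u := fun θ : ℝ => (Real.log ε : ℂ) + θ * Complex.I)
    (k := fun θ : ℝ => Complex.I * expKernel a (ε * Complex.exp (θ * Complex.I)))
    (by fun_prop) (by fun_prop) 0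
  refine ((h2.mul h1).add h4).congr_deriv ?_
  rw [hankelIntegral_logGammaIntegrand ha hε hε', mellin_indicator_Ioi hε]
  simp only [mul_zero, Complex.sin_zero, zero_mul, Complex.exp_zero, one_mul, add_zero, zero_sub]
  congr 2
  refine setIntegral_congr_fun measurableSet_Ioi fun x _ => ?_
  simp only [Complex.cpow_neg_one, expKernel_neg_ofReal]
  ring

theorem exp_mul_log_add {x : ℝ} (hx : 0 < x) (s c : ℂ) :
    (x : ℂ)⁻¹ * Complex.exp (s * ((Real.log x : ℂ) + c)) =
      (x : ℂ) ^ (s - 1) * Complex.exp (s * c) := by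
  have hx' : (x : ℂ) ≠ 0 := by exact_mod_cast hx.ne'
  rw [mul_add, Complex.exp_add, Complex.cpow_sub _ _ hx', Complex.cpow_one,
    Complex.cpow_def_of_ne_zero hx', Complex.ofReal_log hx.le, mul_comm s (Complex.log _)]
  ring

theorem differentiableAt_expKernel_exp (a : ℂ) {ε : ℝ} (hε : 0 < ε) (hε' : ε < 2 * Real.pi)
    {w : ℂ} (hw : w.re ≤ Real.log ε) :
    DifferentiableAt ℂ (fun w => expKernel a (Complex.exp w)) w := by
  have h1 : ‖Complex.exp w‖ ≤ ε := by
    rw [Complex.norm_exp]; exact (Real.le_log_iff_exp_le hε).1 hw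
  exact (differentiableAt_expKernel a (one_sub_exp_ne_zero (Complex.exp_ne_zero w)
    (h1.trans_lt hε'))).comp w Complex.differentiableAt_exp

/-- For Re s > 1 the factor z^(s-1) outweighs the simple pole, so the circle collapses onto (0, ε]
and supplies the missing part of the Mellin integral. -/
theorem hankelTransform_eq_mellin {a s : ℂ} (ha : 0 < a.re) (hs : 1 < s.re) {ε : ℝ} (hε : 0 < ε)
    (hε' : ε < 2 * Real.pi) :
    hankelTransform ε a s = 2 * Complex.I * Complex.sin (Real.pi * s) *
      mellin (fun x : ℝ => expKernel a (-(x : ℂ))) s := by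
  obtain ⟨C, hC⟩ := exists_norm_expKernel_le a hε'
  -- The exponent is Re s from e^(sw) minus 1 from the simple pole; the constant contains the bound
  -- e^(|Im s| π) for the phase in the strip.
  have hcauchy := integral_vertical_eq_integral_Ioc
    (G := fun w => Complex.exp (s * w) * expKernel a (Complex.exp w)) (σ := s.re - 1)
    (C := Real.exp (|s.im| * Real.pi) * C) hε (by linarith)
    (fun w hw => DifferentiableAt.mul (by fun_prop) (differentiableAt_expKernel_exp a hε hε' hw))
    (by
      intro w hw hw'
      have h1 : ‖Complex.exp w‖ ≤ ε := by
        rw [Complex.norm_exp]; exact (Real.le_log_iff_exp_le hε).1 hw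
      have h2 := hC _ (Complex.exp_ne_zero w) h1
      rw [Complex.norm_exp] at h2
      have hC0 : 0 ≤ C * (Real.exp w.re)⁻¹ := (norm_nonneg _).trans h2
      have h3 : ‖Complex.exp (s * w)‖ ≤ Real.exp (|s.im| * Real.pi) * Real.exp (s.re * w.re) := by
        rw [Complex.norm_exp, ← Real.exp_add, Complex.mul_re]
        refine Real.exp_le_exp.2 ?_
        have h4 : -(s.im * w.im) ≤ |s.im| * Real.pi := by
          calc -(s.im * w.im) ≤ |s.im * w.im| := neg_le_abs _
            _ = |s.im| * |w.im| := abs_mul _ _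
            _ ≤ _ := by gcongr
        linarith
      rw [norm_mul]
      calc _ ≤ Real.exp (|s.im| * Real.pi) * Real.exp (s.re * w.re) *
            (C * (Real.exp w.re)⁻¹) := by gcongr
        _ = _ := by
          rw [sub_mul, one_mul, Real.exp_sub]
          ring)
  have hcircle : ∫ θ in (-Real.pi)..Real.pi,
      Complex.exp (s * ((Real.log ε : ℂ) + θ * Complex.I)) *
        (Complex.I * expKernel a (ε * Complex.exp (θ * Complex.I))) =
      2 * Complex.I * Complex.sin (Real.pi * s) *
        ∫ x in Ioc 0 ε, (x : ℂ) ^ (s - 1) * expKernel a (-(x : ℂ)) := by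
    rw [← intervalIntegral.integral_const_mul, ← integral_const_mul] at *
    trans ∫ x in (-Real.pi)..Real.pi, Complex.I *
      (Complex.exp (s * ((Real.log ε : ℂ) + x * Complex.I)) *
        expKernel a (Complex.exp ((Real.log ε : ℂ) + x * Complex.I)))
    · congr 1
      ext θ
      rw [exp_log_add_mul_I hε]
      ring
    rw [hcauchy]
    refine setIntegral_congr_fun measurableSet_Ioc fun x hx => ?_
    have e1 := exp_mul_log_add hx.1 s (Real.pi * Complex.I)
    have e2 := exp_mul_log_add hx.1 s (-(Real.pi * Complex.I))
    have e3 : 2 * Complex.I * Complex.sin (Real.pi * s) =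
        Complex.exp (s * (Real.pi * Complex.I)) - Complex.exp (s * -(Real.pi * Complex.I)) := by
      rw [Complex.sin, show -(Real.pi * s) * Complex.I = s * -(Real.pi * Complex.I) by ring,
        show Real.pi * s * Complex.I = s * (Real.pi * Complex.I) by ring]
      linear_combination (Complex.exp (s * -(Real.pi * Complex.I)) -
        Complex.exp (s * (Real.pi * Complex.I))) * Complex.I_mul_I
    simp only [exp_log_add_pi_mul_I hx.1, exp_log_sub_pi_mul_I hx.1]
    rw [e3]
    rw [← sub_eq_add_neg] at e2
    linear_combination expKernel a (-(x : ℂ)) * e1 - expKernel a (-(x : ℂ)) * e2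
  have hint := mellinConvergent_expKernel_neg ha hs
  rw [hankelTransform, hcircle, mellin_indicator_Ioi hε, mellin, ← mul_add]
  simp only [MellinConvergent, smul_eq_mul] at hint ⊢
  rw [← Ioc_union_Ioi_eq_Ioi hε.le] at hint ⊢
  rw [setIntegral_union (Ioc_disjoint_Ioi le_rfl) measurableSet_Ioi
    (hint.mono_set subset_union_left) (hint.mono_set subset_union_right), add_comm]

/-! ### The Hurwitz zeta function -/

/-- The reflection formula Γ(s) Γ(1-s) sin(πs) = π turns the collapsed integral into the Dirichlet
series. -/
theorem gamma_mul_hankelTransform {a s : ℂ} (ha : 0 < a.re) (hs : 1 < s.re) {ε : ℝ} (hε : 0 < ε)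
    (hε' : ε < 2 * Real.pi) (hsin : Complex.sin (Real.pi * s) ≠ 0) :
    Complex.Gamma (1 - s) * hankelTransform ε a s / (2 * Real.pi * Complex.I) =
      ∑' n : ℕ, 1 / ((n : ℂ) + a) ^ s := by
  have h1 := (hasSum_one_div_cpow ha hs).tsum_eq
  rw [tsum_mul_right] at h1
  rw [hankelTransform_eq_mellin ha hs hε hε', ← h1]
  have h2 := Complex.Gamma_mul_Gamma_one_sub s
  rw [eq_div_iff hsin] at h2
  have hpi : (Real.pi : ℂ) ≠ 0 := by exact_mod_cast Real.pi_ne_zero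
  generalize Complex.sin (Real.pi * s) = S at h2 ⊢
  field_simp
  linear_combination (∑' n : ℕ, 1 / ((n : ℂ) + a) ^ s) * h2

theorem summable_one_div_cpow {a s : ℂ} (ha : 0 < a.re) (hs : 1 < s.re) :
    Summable fun n : ℕ => 1 / ((n : ℂ) + a) ^ s :=
  (summable_mul_right_iff (Complex.Gamma_ne_zero_of_re_pos (by linarith))).1
    (hasSum_one_div_cpow ha hs).summable

open scoped Classical in
/-- The analytic continuation of the Hurwitz zeta function by means of the Hankel contour. -/
noncomputable def hankelZeta (ε : ℝ) (a s : ℂ) : ℂ :=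
  -- The Hankel formula alone fails at s = 2, 3, …, where Γ(1-s) has poles and `Complex.Gamma` takes
  -- the default value 0.
  if 1 < s.re then ∑' n : ℕ, 1 / ((n : ℂ) + a) ^ s
  else Complex.Gamma (1 - s) * hankelTransform ε a s / (2 * Real.pi * Complex.I)

theorem sin_pi_mul_ne_zero_of_one_lt_re {s : ℂ} (hs : 1 < s.re) (h : ∀ n : ℕ, 1 - s ≠ -(n : ℂ)) :
    Complex.sin (Real.pi * s) ≠ 0 := by
  rw [Complex.sin_ne_zero_iff]
  intro k hk
  have hpi : (Real.pi : ℂ) ≠ 0 := by exact_mod_cast Real.pi_ne_zero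
  have hk' : s = k := by
    rw [mul_comm] at hk
    exact mul_right_cancel₀ hpi hk
  rw [hk', Complex.intCast_re] at hs
  have hk1 : 1 < k := by exact_mod_cast hs
  refine h (k - 1).toNat ?_
  have : (((k - 1).toNat : ℤ) : ℂ) = ((k - 1 : ℤ) : ℂ) := by
    rw [Int.toNat_of_nonneg (by omega)]
  rw [← Int.cast_natCast, this, hk']
  push_cast
  ring

theorem hankelZeta_eq {a s : ℂ} (ha : 0 < a.re) {ε : ℝ} (hε : 0 < ε) (hε' : ε < 2 * Real.pi)
    (h : ∀ n : ℕ, 1 - s ≠ -(n : ℂ)) :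
    hankelZeta ε a s =
      Complex.Gamma (1 - s) * hankelTransform ε a s / (2 * Real.pi * Complex.I) := by
  rw [hankelZeta]
  split_ifs with hs
  · exact (gamma_mul_hankelTransform ha hs hε hε' (sin_pi_mul_ne_zero_of_one_lt_re hs h)).symm
  · rfl

theorem isHurwitzZeta_hankelZeta {a : ℂ} (ha : 0 < a.re) {ε : ℝ} (hε : 0 < ε)
    (hε' : ε < 2 * Real.pi) : IsHurwitzZeta a (hankelZeta ε a) := by
  refine ⟨fun s hs => DifferentiableAt.differentiableWithinAt ?_, fun s hs => ?_⟩
  · by_cases h1 : 1 < s.re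
    · have hG : Complex.Gamma s ≠ 0 := Complex.Gamma_ne_zero_of_re_pos (by linarith)
      have hd : DifferentiableAt ℂ
          (fun s => mellin (fun x : ℝ => expKernel a (-(x : ℂ))) s / Complex.Gamma s) s :=
        (differentiableAt_mellin_expKernel_neg ha h1).div
          (differentiableOn_Gamma_halfPlane.differentiableAt
            ((isOpen_lt continuous_const Complex.continuous_re).mem_nhds
              (by linarith : 0 < s.re))) hG
      refine hd.congr_of_eventuallyEq ?_
      filter_upwards [(isOpen_lt continuous_const Complex.continuous_re).mem_nhds h1] with t ht
      have ht' : 1 < t.re := ht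
      have hGt : Complex.Gamma t ≠ 0 := Complex.Gamma_ne_zero_of_re_pos (by linarith)
      rw [hankelZeta, if_pos ht', ← (hasSum_one_div_cpow ha ht').tsum_eq, tsum_mul_right,
        mul_div_cancel_right₀ _ hGt]
    · have hsn : ∀ n : ℕ, 1 - s ≠ -(n : ℂ) := by
        intro n hn
        have hre := congrArg Complex.re hn
        have him := congrArg Complex.im hn
        simp only [Complex.sub_re, Complex.one_re, Complex.neg_re, Complex.natCast_re,
          Complex.sub_im, Complex.one_im, Complex.neg_im, Complex.natCast_im] at hre him
        have hn0 : (0 : ℝ) ≤ n := Nat.cast_nonneg n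
        exact hs (Complex.ext (by simp; linarith) (by simp; linarith))
      have hd : DifferentiableAt ℂ (fun s => Complex.Gamma (1 - s) * hankelTransform ε a s /
          (2 * Real.pi * Complex.I)) s := by
        refine DifferentiableAt.div_const (DifferentiableAt.mul ?_
          (differentiable_hankelTransform ha hε hε' s)) _
        exact (Complex.differentiableAt_Gamma _ hsn).comp s
          (f := fun s : ℂ => 1 - s) (by fun_prop)
      refine hd.congr_of_eventuallyEq ?_
      -- Of the poles 1, 2, 3, … of Γ(1-t), this neighbourhood contains none, so the Hankel formula
      -- holds throughout it.
      have hball : {t : ℂ | t.re < 2} ∩ {1}ᶜ ∈ nhds s :=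
        ((isOpen_lt Complex.continuous_re continuous_const).inter isOpen_compl_singleton).mem_nhds
          ⟨by show s.re < 2; linarith [not_lt.1 h1], hs⟩
      filter_upwards [hball] with t ht
      refine hankelZeta_eq ha hε hε' fun n hn => ?_
      have ht2 : t.re < 2 := ht.1
      have ht' : t = 1 + n := by linear_combination -hn
      have hn1 : (n : ℝ) < 1 := by
        rw [ht'] at ht2
        simp only [Complex.add_re, Complex.one_re, Complex.natCast_re] at ht2
        linarith
      have hn0 : n = 0 := by
        have : n < 1 := by exact_mod_cast hn1
        omega
      rw [hn0] at ht'
      exact ht.2 (by simpa using ht')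
  · rw [hankelZeta, if_pos hs]
    exact (summable_one_div_cpow ha hs).hasSum

theorem isHurwitzZeta_hurwitzZetaC {a : ℂ} (ha : 0 < a.re) :
    IsHurwitzZeta a (fun s => hurwitzZetaC s a) := by
  have h : ∃ Z : ℂ → ℂ, IsHurwitzZeta a Z :=
    ⟨_, isHurwitzZeta_hankelZeta ha one_pos (by linarith [Real.pi_gt_three])⟩
  have he : (fun s => hurwitzZetaC s a) = h.choose := by
    ext s
    rw [hurwitzZetaC, dif_pos h]
  rw [he]
  exact h.choose_spec

theorem IsHurwitzZeta.eqOn {a : ℂ} {Z W : ℂ → ℂ} (hZ : IsHurwitzZeta a Z)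
    (hW : DifferentiableOn ℂ W {1}ᶜ) (h : ∀ s : ℂ, 1 < s.re → Z s = W s) : EqOn Z W {1}ᶜ := by
  refine (hZ.1.analyticOnNhd isOpen_compl_singleton).eqOn_of_preconnected_of_eventuallyEq
    (hW.analyticOnNhd isOpen_compl_singleton)
    (isConnected_compl_singleton_of_one_lt_rank (by simp) 1).isPreconnected
    (z₀ := 2) (by simp) ?_
  filter_upwards [(isOpen_lt continuous_const Complex.continuous_re).mem_nhds
    (by simp : (1 : ℝ) < (2 : ℂ).re)] with s hs using h s hs

theorem eventuallyEq_zero_of_eqOn {Z W : ℂ → ℂ} (h : EqOn Z W {1}ᶜ) : Z =ᶠ[nhds 0] W :=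
  h.eventuallyEq_of_mem (isOpen_compl_singleton.mem_nhds (by simp))

/-- Only the values near 0 matter, and ψ(1) = -γ. -/
theorem hurwitzG_zero_eq {a : ℂ} {W : ℂ → ℂ}
    (h : EqOn (fun s => hurwitzZetaC s a) W {1}ᶜ) :
    hurwitzG 0 a = deriv W 0 - Real.eulerMascheroniConstant * W 0 := by
  have he := eventuallyEq_zero_of_eqOn h
  rw [hurwitzG]
  simp only [CharP.cast_eq_zero, neg_zero, zero_add, Complex.digamma_one]
  rw [he.deriv_eq, show hurwitzZetaC 0 a = W 0 from he.eq_of_nhds]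
  ring

theorem hurwitzG_zero_eq_hankelIntegral {a : ℂ} (ha : 0 < a.re) {ε : ℝ} (hε : 0 < ε)
    (hε' : ε < 2 * Real.pi) :
    hurwitzG 0 a =
      1 / (2 * Real.pi * Complex.I) * hankelIntegral ε (logGammaIntegrand a) := by
  have hZ := isHurwitzZeta_hankelZeta ha hε hε'
  have he := (isHurwitzZeta_hurwitzZetaC ha).eqOn hZ.1 fun s hs =>
    ((isHurwitzZeta_hurwitzZetaC ha).2 s hs).unique (hZ.2 s hs)
  rw [hurwitzG_zero_eq he]
  have hnear : hankelZeta ε a =ᶠ[nhds 0] fun s =>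
      Complex.Gamma (1 - s) * hankelTransform ε a s / (2 * Real.pi * Complex.I) := by
    filter_upwards [(isOpen_lt Complex.continuous_re continuous_const).mem_nhds
      (by simp : (0 : ℂ).re < (1 : ℝ))] with s hs
    have hs' : s.re < 1 := hs
    rw [hankelZeta, if_neg (by linarith)]
  rw [hnear.deriv_eq, hnear.eq_of_nhds]
  have hG : HasDerivAt (fun s : ℂ => Complex.Gamma (1 - s))
      (Real.eulerMascheroniConstant : ℂ) 0 := by
    have h1 : HasDerivAt (fun s : ℂ => 1 - s) (-1) 0 := by
      simpa using (hasDerivAt_id (0 : ℂ)).const_sub 1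
    have h2 : HasDerivAt Complex.Gamma (-(Real.eulerMascheroniConstant : ℂ)) (1 - 0) := by
      rw [sub_zero]; exact Complex.hasDerivAt_Gamma_one
    exact (h2.comp (0 : ℂ) h1).congr_deriv (by ring)
  have h := ((hG.mul (hasDerivAt_hankelTransform_zero ha hε hε')).div_const
    (2 * Real.pi * Complex.I)).deriv
  simp only [Pi.mul_apply] at h
  rw [show deriv (fun s => Complex.Gamma (1 - s) * hankelTransform ε a s /
    (2 * Real.pi * Complex.I)) 0 = _ from h]
  simp only [sub_zero, Complex.Gamma_one]
  ring

/-! ### The recurrence of g(0, a) and its value at a = 1 -/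

/-- Dropping the first term of the series gives ζ(s,a+1) = ζ(s,a) - a^(-s). At s = 0 the function
-a^(-s) has derivative log a and value -1, whence log a and +γ. -/
theorem hurwitzG_zero_add_one {a : ℂ} (ha : 0 < a.re) :
    hurwitzG 0 (a + 1) = hurwitzG 0 a + Complex.log a + Real.eulerMascheroniConstant := by
  have ha0 : a ≠ 0 := by
    rintro rfl
    simp at ha
  have ha1 : 0 < (a + 1).re := by simp; linarith
  have hZ := isHurwitzZeta_hurwitzZetaC ha
  have hd : Differentiable ℂ fun s : ℂ => a ^ (-s) := fun s =>
    (differentiableAt_id.neg).const_cpow (Or.inl ha0)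
  have he := (isHurwitzZeta_hurwitzZetaC ha1).eqOn (W := fun s => hurwitzZetaC s a - a ^ (-s))
    (hZ.1.sub hd.differentiableOn) fun s hs => by
      refine ((isHurwitzZeta_hurwitzZetaC ha1).2 s hs).unique ?_
      have h := (hasSum_nat_add_iff' 1).2 (hZ.2 s hs)
      simp only [Finset.range_one, Finset.sum_singleton, Nat.cast_zero, zero_add] at h
      rw [Complex.cpow_neg, ← one_div]
      convert! h using 4 with n
      push_cast
      ring
  rw [hurwitzG_zero_eq he, hurwitzG_zero_eq (fun s _ => rfl : EqOn (fun s => hurwitzZetaC s a)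
    (fun s => hurwitzZetaC s a) {1}ᶜ)]
  have h1 : HasDerivAt (fun s : ℂ => a ^ (-s)) (-Complex.log a) 0 := by
    have := (hasDerivAt_neg (0 : ℂ)).const_cpow (c := a) (Or.inl ha0)
    simpa using this
  have h2 : DifferentiableAt ℂ (fun s => hurwitzZetaC s a) 0 :=
    hZ.1.differentiableAt (isOpen_compl_singleton.mem_nhds (by simp))
  rw [show deriv (fun s => hurwitzZetaC s a - a ^ (-s)) 0 = _ from
    (h2.hasDerivAt.sub h1).deriv]
  simp
  ring

theorem hurwitzG_zero_one : hurwitzG 0 1 =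
    -Real.log (Real.sqrt (2 * Real.pi)) + Real.eulerMascheroniConstant / 2 := by
  have hZ := isHurwitzZeta_hurwitzZetaC (a := 1) (by simp)
  have he := hZ.eqOn (W := riemannZeta)
    (fun s hs => (differentiableAt_riemannZeta hs).differentiableWithinAt) fun s hs => by
      rw [zeta_eq_tsum_one_div_nat_add_one_cpow hs, (hZ.2 s hs).tsum_eq]
  rw [hurwitzG_zero_eq he, deriv_riemannZeta_zero, riemannZeta_zero, Real.log_sqrt (by positivity),
    show (2 * Real.pi : ℂ) = ((2 * Real.pi : ℝ) : ℂ) by push_cast; rfl,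
    ← Complex.ofReal_log (by positivity)]
  push_cast
  ring

/-! ### Convexity of `g(0, a)` in `a` -/

/-- The part of the circle integrand of radius `1` that does not depend on `a`. -/
noncomputable def unitCircleWeight (θ : ℝ) : ℂ :=
  θ * Complex.I * (Complex.I * (1 - Complex.exp (Complex.exp (θ * Complex.I)))⁻¹)

theorem one_sub_exp_unitCircle_ne_zero (θ : ℝ) :
    1 - Complex.exp (Complex.exp (θ * Complex.I)) ≠ 0 := by
  simpa using one_sub_exp_circle_ne_zero one_pos (by linarith [Real.pi_gt_three]) θ

theorem continuous_unitCircleWeight : Continuous unitCircleWeight :=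
  Continuous.mul (by fun_prop) (Continuous.mul continuous_const
    (Continuous.inv₀ (by fun_prop) one_sub_exp_unitCircle_ne_zero))

/-- With radius 1 the term log ε vanishes, and `a` occurs only in exponentials, ready for
differentiation under the integral. -/
theorem hurwitzG_zero_eq_unitCircle {a : ℂ} (ha : 0 < a.re) :
    hurwitzG 0 a = (∫ x in Ioi (1 : ℝ), Complex.exp (-a * x) *
        ((x : ℂ)⁻¹ * (1 - Complex.exp (-(x : ℂ)))⁻¹)) +
      1 / (2 * Real.pi * Complex.I) * ∫ θ in (-Real.pi)..Real.pi,
        Complex.exp (a * Complex.exp (θ * Complex.I)) * unitCircleWeight θ := by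
  have h1 : (1 : ℝ) < 2 * Real.pi := by linarith [Real.pi_gt_three]
  rw [hurwitzG_zero_eq_hankelIntegral ha one_pos h1,
    hankelIntegral_logGammaIntegrand ha one_pos h1, mul_add, ← mul_assoc]
  have hpi : (Real.pi : ℂ) ≠ 0 := by exact_mod_cast Real.pi_ne_zero
  rw [one_div_mul_cancel (by simp [hpi]), one_mul]
  congr 2
  refine intervalIntegral.integral_congr fun θ _ => ?_
  simp only [Real.log_one, Complex.ofReal_zero, Complex.ofReal_one, zero_add, one_mul, expKernel,
    unitCircleWeight]
  ring

/-- The derivative of `hurwitzG 0` on the right half-plane. -/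
noncomputable def hurwitzGDeriv (a : ℂ) : ℂ :=
  (∫ x in Ioi (1 : ℝ), Complex.exp (-a * x) *
      (-(x : ℂ) * ((x : ℂ)⁻¹ * (1 - Complex.exp (-(x : ℂ)))⁻¹))) +
    1 / (2 * Real.pi * Complex.I) * ∫ θ in (-Real.pi)..Real.pi,
      Complex.exp (a * Complex.exp (θ * Complex.I)) *
        (Complex.exp (θ * Complex.I) * unitCircleWeight θ)

theorem hasDerivAt_hurwitzG_zero {a : ℂ} (ha : 0 < a.re) :
    HasDerivAt (hurwitzG 0) (hurwitzGDeriv a) a := by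
  have hw := continuous_unitCircleWeight
  have h := ((laplaceIntegrable_inv_mul_inv_one_sub_exp_neg one_pos).hasDerivAt zero_le_one ha).add
    ((hasDerivAt_integral_exp_mul (α := -Real.pi) (β := Real.pi)
      (u := fun θ : ℝ => Complex.exp (θ * Complex.I)) (by fun_prop) hw a).const_mul
      (1 / (2 * Real.pi * Complex.I)))
  refine h.congr_of_eventuallyEq ?_
  filter_upwards [(isOpen_lt continuous_const Complex.continuous_re).mem_nhds ha] with z hz
  exact hurwitzG_zero_eq_unitCircle hz

/-- Two derivatives in `a` produce a factor z^2, which cancels both z^(-1) and the pole of the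
kernel. The circle then collapses onto the cut, where Log z contributes its jump 2πi. -/
theorem integral_unitCircle_eq_integral_Ioc (a : ℂ) :
    1 / (2 * Real.pi * Complex.I) * ∫ θ in (-Real.pi)..Real.pi,
      Complex.exp (a * Complex.exp (θ * Complex.I)) *
        (Complex.exp (θ * Complex.I) * (Complex.exp (θ * Complex.I) * unitCircleWeight θ)) =
      ∫ x in Ioc (0 : ℝ) 1, Complex.exp (-a * x) *
        ((x : ℂ) * (1 - Complex.exp (-(x : ℂ)))⁻¹) := by
  have hlt : (1 : ℝ) < 2 * Real.pi := by linarith [Real.pi_gt_three]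
  obtain ⟨C, hC⟩ := exists_norm_expKernel_le a hlt
  -- The measure dz = z dw accounts for one factor in e^(2w). The decay rate is 1/2 = 2 - 1 - 1/2:
  -- from e^(2w), the pole, and the growth of w, bounded by a multiple of e^(-Re w / 2).
  have hcauchy := integral_vertical_eq_integral_Ioc
    (G := fun w => w * Complex.exp (2 * w) * expKernel a (Complex.exp w)) (σ := 1 / 2)
    (C := (2 + Real.pi) * C) one_pos (by norm_num)
    (fun w hw => DifferentiableAt.mul (by fun_prop)
      (differentiableAt_expKernel_exp a one_pos hlt hw))
    (by
      intro w hw hw'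
      have hw0 : w.re ≤ 0 := by simpa using hw
      have h1 : ‖Complex.exp w‖ ≤ 1 := by
        rw [Complex.norm_exp]; exact Real.exp_le_one_iff.2 hw0
      have h2 := hC _ (Complex.exp_ne_zero w) h1
      rw [Complex.norm_exp] at h2
      have hC0 : 0 ≤ C * (Real.exp w.re)⁻¹ := (norm_nonneg _).trans h2
      have h3 : ‖w‖ ≤ (2 + Real.pi) * Real.exp (-(w.re / 2)) := by
        have h4 := Real.add_one_le_exp (-(w.re / 2))
        have h5 : 1 ≤ Real.exp (-(w.re / 2)) := Real.one_le_exp (by linarith)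
        have h6 := Complex.norm_le_abs_re_add_abs_im w
        rw [abs_of_nonpos hw0] at h6
        nlinarith [Real.pi_pos]
      have h7 : ‖Complex.exp (2 * w)‖ = Real.exp (2 * w.re) := by
        simp [Complex.norm_exp]
      rw [norm_mul, norm_mul, h7]
      calc _ ≤ (2 + Real.pi) * Real.exp (-(w.re / 2)) * Real.exp (2 * w.re) *
            (C * (Real.exp w.re)⁻¹) := by gcongr
        _ = (2 + Real.pi) * C * (Real.exp (-(w.re / 2)) * Real.exp (2 * w.re) *
            (Real.exp w.re)⁻¹) := by ring
        _ = _ := by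
          rw [← Real.exp_neg, ← Real.exp_add, ← Real.exp_add]
          ring_nf)
  have hpi : (Real.pi : ℂ) ≠ 0 := by exact_mod_cast Real.pi_ne_zero
  have hI : (2 * Real.pi * Complex.I : ℂ) ≠ 0 := by simp [hpi]
  rw [one_div, inv_mul_eq_iff_eq_mul₀ hI, ← integral_const_mul]
  rw [← intervalIntegral.integral_const_mul] at hcauchy
  trans ∫ θ in (-Real.pi)..Real.pi, Complex.I *
      (((Real.log 1 : ℝ) + θ * Complex.I) * Complex.exp (2 * ((Real.log 1 : ℝ) + θ * Complex.I)) *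
        expKernel a (Complex.exp ((Real.log 1 : ℝ) + θ * Complex.I)))
  · refine intervalIntegral.integral_congr fun θ _ => ?_
    simp only [Real.log_one, Complex.ofReal_zero, zero_add, expKernel, unitCircleWeight,
      two_mul, Complex.exp_add]
    ring
  rw [hcauchy]
  refine setIntegral_congr_fun measurableSet_Ioc fun x hx => ?_
  have hx0 : (x : ℂ) ≠ 0 := by exact_mod_cast hx.1.ne'
  simp only [two_mul, Complex.exp_add (_ + _) (_ + _), Complex.exp_add (_ - _) (_ - _),
    exp_log_add_pi_mul_I hx.1, exp_log_sub_pi_mul_I hx.1, expKernel_neg_ofReal]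
  field_simp
  ring

/-- The collapsed circle supplies (0, 1] and the rays supply (1, ∞) of a single Laplace integral. -/
theorem hasDerivAt_hurwitzGDeriv {a : ℂ} (ha : 0 < a.re) :
    HasDerivAt hurwitzGDeriv (∫ x in Ioi (0 : ℝ), Complex.exp (-a * x) *
        ((x : ℂ) * (1 - Complex.exp (-(x : ℂ)))⁻¹)) a := by
  have hw := continuous_unitCircleWeight
  have h := ((laplaceIntegrable_inv_mul_inv_one_sub_exp_neg one_pos).mul_id
    zero_le_one |>.hasDerivAt zero_le_one ha).add
    ((hasDerivAt_integral_exp_mul (α := -Real.pi) (β := Real.pi)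
      (u := fun θ : ℝ => Complex.exp (θ * Complex.I))
      (k := fun θ : ℝ => Complex.exp (θ * Complex.I) * unitCircleWeight θ)
      (by fun_prop) (by fun_prop) a).const_mul
      (1 / (2 * Real.pi * Complex.I)))
  refine h.congr_deriv ?_
  have hint := laplaceIntegrable_mul_inv_one_sub_exp_neg.integrableOn ha
  rw [integral_unitCircle_eq_integral_Ioc]
  rw [← Ioc_union_Ioi_eq_Ioi zero_le_one] at hint ⊢
  rw [setIntegral_union (Ioc_disjoint_Ioi le_rfl) measurableSet_Ioi
    (hint.mono_set subset_union_left) (hint.mono_set subset_union_right), add_comm]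
  congr 1
  refine setIntegral_congr_fun measurableSet_Ioi fun x hx => ?_
  have hx0 : (x : ℂ) ≠ 0 := by exact_mod_cast (zero_lt_one.trans hx).ne'
  field_simp

theorem re_integral_exp_neg_mul_nonneg (y : ℝ) :
    0 ≤ (∫ x in Ioi (0 : ℝ), Complex.exp (-(y : ℂ) * x) *
        ((x : ℂ) * (1 - Complex.exp (-(x : ℂ)))⁻¹)).re := by
  have h : ∀ x : ℝ, Complex.exp (-(y : ℂ) * x) * ((x : ℂ) * (1 - Complex.exp (-(x : ℂ)))⁻¹) =
      ((Real.exp (-y * x) * (x * (1 - Real.exp (-x))⁻¹) : ℝ) : ℂ) := by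
    intro x; push_cast; rfl
  simp_rw [h]
  rw [integral_complex_ofReal, Complex.ofReal_re]
  refine setIntegral_nonneg measurableSet_Ioi fun x hx => ?_
  have hx0 : 0 < x := hx
  have := one_sub_exp_neg_pos hx0
  positivity

/-- The ray integral is real. On the circle conjugation amounts to θ ↦ -θ with a change of sign,
which cancels that of 1/(2πi). -/
theorem conj_hurwitzG_zero_ofReal {x : ℝ} (hx : 0 < x) :
    (starRingEnd ℂ) (hurwitzG 0 x) = hurwitzG 0 x := by
  have hx' : 0 < (x : ℂ).re := by simpa using hx
  have hpi := Real.pi_pos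
  rw [hurwitzG_zero_eq_unitCircle hx', map_add, map_mul]
  congr 1
  · rw [← integral_conj]
    refine setIntegral_congr_fun measurableSet_Ioi fun y _ => ?_
    simp [← Complex.exp_conj]
  · have h1 : (starRingEnd ℂ) (1 / (2 * Real.pi * Complex.I)) =
        -(1 / (2 * Real.pi * Complex.I)) := by
      simp [Complex.conj_ofNat]
    rw [h1, intervalIntegral.integral_of_le (by linarith), ← integral_conj,
      ← intervalIntegral.integral_of_le (by linarith), neg_mul, ← mul_neg,
      ← intervalIntegral.integral_neg]
    congr 1
    trans ∫ θ in (-Real.pi)..Real.pi, (fun θ : ℝ =>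
      Complex.exp (x * Complex.exp (θ * Complex.I)) * unitCircleWeight θ) (-θ)
    · refine intervalIntegral.integral_congr fun θ _ => ?_
      simp only [unitCircleWeight, map_mul, ← Complex.exp_conj, map_inv₀, map_sub, map_one,
        Complex.conj_ofReal, Complex.conj_I, Complex.ofReal_neg, mul_neg, neg_mul, neg_neg]
    · rw [← intervalIntegral.integral_of_le (by linarith), intervalIntegral.integral_comp_neg
        (fun θ : ℝ => Complex.exp (x * Complex.exp (θ * Complex.I)) * unitCircleWeight θ), neg_neg]

theorem hurwitzG_zero_ofReal {x : ℝ} (hx : 0 < x) :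
    hurwitzG 0 x = ((hurwitzG 0 x).re : ℂ) :=
  (Complex.conj_eq_iff_re.1 (conj_hurwitzG_zero_ofReal hx)).symm

/-- The linear term leaves the second derivative unchanged; it is there to remove the constant γ
from the recurrence. -/
theorem convexOn_hurwitzG_zero_re_sub (c : ℝ) :
    ConvexOn ℝ (Ioi 0) fun x : ℝ => (hurwitzG 0 x).re - c * x := by
  have h1 : ∀ x : ℝ, 0 < x → HasDerivAt (fun x : ℝ => (hurwitzG 0 x).re - c * x)
      ((hurwitzGDeriv x).re - c) x := fun x hx => by
    simpa using! (hasDerivAt_hurwitzG_zero (a := x) (by simpa using hx)).real_of_complex.sub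
      ((hasDerivAt_id x).const_mul c)
  have h2 : ∀ x : ℝ, 0 < x → HasDerivAt (fun x : ℝ => (hurwitzGDeriv x).re - c) _ x :=
    fun x hx =>
      (hasDerivAt_hurwitzGDeriv (a := x) (by simpa using hx)).real_of_complex.sub_const c
  refine convexOn_of_hasDerivWithinAt2_nonneg (convex_Ioi 0)
    (fun x hx => (h1 x hx).continuousAt.continuousWithinAt)
    (f' := fun x => (hurwitzGDeriv x).re - c)
    (f'' := fun y => (∫ x in Ioi (0 : ℝ), Complex.exp (-(y : ℂ) * x) *
        ((x : ℂ) * (1 - Complex.exp (-(x : ℂ)))⁻¹)).re) ?_ ?_ ?_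
  all_goals
    intro x hx
    rw [interior_Ioi] at *
  · exact (h1 x hx).hasDerivWithinAt
  · exact (h2 x hx).hasDerivWithinAt
  · exact re_integral_exp_neg_mul_nonneg x

/-! ### Lerch's formula -/

theorem logGamma_eq_hurwitzG_ofReal {x : ℝ} (hx : 0 < x) :
    logGamma x = (Real.log (Real.sqrt (2 * Real.pi)) : ℂ)
      - (Real.eulerMascheroniConstant : ℂ) * (x - 1 / 2) + hurwitzG 0 x := by
  -- Convexity and the recurrence force the Euler sequence to converge to f(x) - f(1); the same
  -- sequence converges to log Γ(x).
  have hlim := Real.BohrMollerup.tendsto_logGammaSeq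
    (convexOn_hurwitzG_zero_re_sub Real.eulerMascheroniConstant) (fun {y} hy => by
      have h := congrArg Complex.re (hurwitzG_zero_add_one (a := y) (by simpa using hy))
      rw [Complex.add_re, Complex.add_re, Complex.log_ofReal_re, Complex.ofReal_re] at h
      push_cast
      rw [h]
      ring) hx
  have h := tendsto_nhds_unique hlim (Real.BohrMollerup.tendsto_log_gamma hx)
  have h1 := congrArg Complex.re hurwitzG_zero_one
  have h2 : (-(Real.log (Real.sqrt (2 * Real.pi)) : ℂ) + Real.eulerMascheroniConstant / 2).re =
      -Real.log (Real.sqrt (2 * Real.pi)) + Real.eulerMascheroniConstant / 2 := by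
    rw [show -(Real.log (Real.sqrt (2 * Real.pi)) : ℂ) + Real.eulerMascheroniConstant / 2 =
      ((-Real.log (Real.sqrt (2 * Real.pi)) + Real.eulerMascheroniConstant / 2 : ℝ) : ℂ) by
        push_cast; rfl, Complex.ofReal_re]
  rw [h2] at h1
  rw [logGamma_ofReal hx, hurwitzG_zero_ofReal hx, ← h, Complex.ofReal_one, h1]
  push_cast
  ring

theorem logGamma_eq_hurwitzG {a : ℂ} (ha : 0 < a.re) :
    logGamma a = (Real.log (Real.sqrt (2 * Real.pi)) : ℂ)
      - (Real.eulerMascheroniConstant : ℂ) * (a - 1 / 2) + hurwitzG 0 a := by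
  refine eq_of_eq_on_pos_reals (g := fun a => (Real.log (Real.sqrt (2 * Real.pi)) : ℂ)
      - (Real.eulerMascheroniConstant : ℂ) * (a - 1 / 2) + hurwitzG 0 a)
    (fun z hz => (hasDerivAt_logGamma hz).differentiableAt.differentiableWithinAt)
    (fun z hz => DifferentiableAt.differentiableWithinAt ?_)
    (fun x hx => logGamma_eq_hurwitzG_ofReal hx) ha
  exact DifferentiableAt.add (by fun_prop) (hasDerivAt_hurwitzG_zero hz).differentiableAt

theorem lemma3 (a : ℂ) (ha : 0 < a.re) :
    (∀ ε : ℝ, 0 < ε → ε < 2 * Real.pi →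
      HankelIntegrable ε
          (fun z w => z⁻¹ * Complex.exp (a * z) * w / (1 - Complex.exp z)) ∧
        logGamma a =
          (Real.log (Real.sqrt (2 * Real.pi)) : ℂ)
            - (Real.eulerMascheroniConstant : ℂ) * (a - 1 / 2)
            + 1 / (2 * Real.pi * Complex.I) *
              hankelIntegral ε
                (fun z w => z⁻¹ * Complex.exp (a * z) * w / (1 - Complex.exp z))) ∧
    IsHurwitzZeta a (fun s => hurwitzZetaC s a) ∧
    logGamma a =
      (Real.log (Real.sqrt (2 * Real.pi)) : ℂ)
        - (Real.eulerMascheroniConstant : ℂ) * (a - 1 / 2)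
        + hurwitzG 0 a := by
  refine ⟨fun ε hε hε' => ⟨hankelIntegrable_logGammaIntegrand ha hε hε', ?_⟩,
    isHurwitzZeta_hurwitzZetaC ha, logGamma_eq_hurwitzG ha⟩
  rw [logGamma_eq_hurwitzG ha, hurwitzG_zero_eq_hankelIntegral ha hε hε']
  rfl
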